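/- Let $d\ge 1$, let $\lambda_d$ be Lebesgue measure on $\mathbb R^d$, and let $B_r$ be the closed ball of radius $r$ around $0$. Let $\mathbf N$ be the space of locally finite measures on $\mathbb R^d$ with values in $\{0,1,2,\dots\}\cup\{\infty\}$, with the smallest $\sigma$-field making all maps $\varphi\mapsto\varphi(B)$, $B$ Borel, measurable; a point process is a random element of $\mathbf N$. For $\varphi\in\mathbf N$ and $x\in\mathbb R^d$ let $\varphi-x:=\varphi(\cdot+x)$ and let $\varphi\cap B_1$ be the restriction of $\varphi$ to $B_1$. Let $Y_1\colon\mathbf N\to\{0,1\}$ and $Y_2\colon\mathbf N\to B_1$ be measurable with $Y_j(\varphi)=Y_j(\varphi\cap B_1)$ for all $\varphi\in\mathbf N$, $j\in\{1,2\}$. Let $\Phi$ be a stationary Poisson process on $\mathbb R^d$ with intensity $\gamma\in(0,\infty)$, and let $U_{k,i}$, $k,i\ge 1$, be i.i.d. $B_1$-valued random vectors independent of $\Phi$. Let $\Phi_0=\Phi,\Phi_1,\Phi_2,\dots$ be point processes such that for each $k\ge1$, almost surely, $$\Phi_{k-1}=\sum_i\delta_{X_i},\qquad \Phi_k=\sum_i\delta_{X_i+Y_1(\Phi_{k-1}-X_i)\,\left(Y_2(\Phi_{k-1}-X_i)+U_{k,i}\right)},\qquad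 1\le i\le\Phi_{k-1}(\mathbb R^d),\ i<\infty,$$ where $X_1,X_2,\dots$ (depending on $k$) are random vectors listing the points of $\Phi_{k-1}$ with multiplicity, without using the noise of the current step, in the sense that $(\Phi_{k-1},(X_i)_{i\ge1})$ is independent of $(U_{k,i})_{i\ge1}$. Then $\Phi$ and all $\Phi_k$, $k\ge1$, are locally square-integrable (that is, $\mathbb E[\Phi(B)^2]<\infty$ and $\mathbb E[\Phi_k(B)^2]<\infty$ for all bounded Borel sets $B$), and for every $k\ge 1$ $$\lim_{r\to\infty}\lambda_d(B_r)^{-1}\operatorname{Var}[\Phi_k(B_r)]=\lim_{r\to\infty}\lambda_d(B_r)^{-1}\operatorname{Var}[\Phi(B_r)]=\gamma .$$ In particular no $\Phi_k$ is hyperuniform, i.e. $\lambda_d(B_r)^{-1}\operatorname{Var}[\Phi_k(B_r)]$ does not tend to $0$ as $r\to\infty$. -/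

import Mathlib

open MeasureTheory ProbabilityTheory Filter Topology Metric
open scoped NNReal ENNReal

noncomputable section

namespace RandomOrganization

/-- Locally finite measures on `ℝ^d` with values in `ℕ ∪ {∞}`. -/
def IsPointMeasure {d : ℕ} (φ : Measure (EuclideanSpace ℝ (Fin d))) : Prop :=
  IsLocallyFiniteMeasure φ ∧
    ∀ B : Set (EuclideanSpace ℝ (Fin d)), MeasurableSet B → ∃ n : ℕ∞, φ B = (n : ℝ≥0∞)

/-- The space `N` of locally finite counting measures on `ℝ^d`, multiplicities allowed. Its
σ-algebra, the trace of the one on measures, is the smallest one that makes all evaluations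
`φ ↦ φ B`, `B` Borel, measurable. -/
abbrev PointMeasure (d : ℕ) : Type :=
  {φ : Measure (EuclideanSpace ℝ (Fin d)) // IsPointMeasure φ}

/-- The closed unit ball `B_1` of `ℝ^d`. -/
abbrev UnitBall (d : ℕ) : Type :=
  (closedBall (0 : EuclideanSpace ℝ (Fin d)) 1 : Set (EuclideanSpace ℝ (Fin d)))

/-- The shifted configuration `φ - x`, that is `B ↦ φ (B + x)`. -/
def shift {d : ℕ} (φ : PointMeasure d) (x : EuclideanSpace ℝ (Fin d)) : PointMeasure d :=
  ⟨φ.1.map (fun y => y - x), by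
    have hm : Measurable (fun y : EuclideanSpace ℝ (Fin d) => y - x) := by fun_prop
    refine ⟨⟨fun y => ?_⟩, fun B hB => ?_⟩
    · have := φ.2.1
      obtain ⟨s, hs, hlt⟩ := φ.1.exists_isOpen_measure_lt_top (y + x)
      have hc : Continuous (fun z : EuclideanSpace ℝ (Fin d) => z + x) := by fun_prop
      refine ⟨(fun z => z + x) ⁻¹' s, (hlt.1.preimage hc).mem_nhds hs, ?_⟩
      rw [Measure.map_apply hm (hlt.1.preimage hc).measurableSet]
      simpa [Set.preimage_preimage] using hlt.2
    · rw [Measure.map_apply hm hB]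
      exact φ.2.2 _ (hm hB)⟩

/-- The restricted configuration `φ ∩ B_1`. -/
def restrictUnitBall {d : ℕ} (φ : PointMeasure d) : PointMeasure d :=
  ⟨φ.1.restrict (closedBall 0 1), by
    refine ⟨?_, fun B hB => ?_⟩
    · have := φ.2.1
      infer_instance
    · rw [Measure.restrict_apply hB]
      exact φ.2.2 _ (hB.inter measurableSet_closedBall)⟩

/-- A function of configurations is local if it only depends on the configuration in `B_1`. -/
def IsLocal {d : ℕ} {α : Type*} (Y : PointMeasure d → α) : Prop :=
  ∀ φ, Y φ = Y (restrictUnitBall φ)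

/-- `Φ` is a Poisson process on `ℝ^d` with intensity measure `γ • volume`. -/
structure IsStationaryPoisson {Ω : Type*} [MeasurableSpace Ω] (P : Measure Ω) {d : ℕ} (γ : ℝ≥0)
    (Φ : Ω → PointMeasure d) : Prop where
  measurable : Measurable Φ
  /-- The number of points in `B` is Poisson distributed with mean `γ * volume B`. -/
  counts : ∀ B : Set (EuclideanSpace ℝ (Fin d)), MeasurableSet B → volume B < ∞ →
    P.map (fun ω => (Φ ω).1 B) =
      (poissonMeasure (γ * (volume B).toNNReal)).map (fun n : ℕ => (n : ℝ≥0∞))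
  /-- The numbers of points in pairwise disjoint sets are independent. -/
  indep : ∀ (m : ℕ) (B : Fin m → Set (EuclideanSpace ℝ (Fin d))), (∀ j, MeasurableSet (B j)) →
    Pairwise (fun i j => Disjoint (B i) (B j)) →
    iIndepFun (fun j ω => (Φ ω).1 (B j)) P

/-- The index set of the points of `φ`: the `i : ℕ` that are smaller than the total number of
points (so all of `ℕ` if there are infinitely many points). -/
abbrev Index {d : ℕ} (φ : PointMeasure d) : Type :=
  {i : ℕ // (i : ℝ≥0∞) < φ.1 Set.univ}

/-- The new position `x + Y₁(φ - x) (Y₂(φ - x) + u)` of a point `x` of `φ`. -/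
def displace {d : ℕ} (Y₁ : PointMeasure d → ({0, 1} : Set ℝ)) (Y₂ : PointMeasure d → UnitBall d)
    (φ : PointMeasure d) (x : EuclideanSpace ℝ (Fin d)) (u : UnitBall d) :
    EuclideanSpace ℝ (Fin d) :=
  x + (Y₁ (shift φ x) : ℝ) •
    ((Y₂ (shift φ x) : EuclideanSpace ℝ (Fin d)) + (u : EuclideanSpace ℝ (Fin d)))

/-- One update from the point process `Φ` to the point process `Φ'` with the noise `V`: the
points of `Φ` are listed (with multiplicities) as random vectors `X i`, in some way that does
not use the noise of this step, and the `i`-th point is displaced with the help of `V i`. -/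
def IsUpdate {Ω : Type*} [MeasurableSpace Ω] (P : Measure Ω) {d : ℕ}
    (Y₁ : PointMeasure d → ({0, 1} : Set ℝ)) (Y₂ : PointMeasure d → UnitBall d)
    (V : ℕ → Ω → UnitBall d) (Φ Φ' : Ω → PointMeasure d) : Prop :=
  ∃ X : ℕ → Ω → EuclideanSpace ℝ (Fin d),
    (∀ i, Measurable (X i)) ∧
    IndepFun (fun ω => (Φ ω, fun i => X i ω)) (fun ω i => V i ω) P ∧
    (∀ᵐ ω ∂P, (Φ ω).1 = Measure.sum (fun i : Index (Φ ω) => Measure.dirac (X i ω))) ∧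
    (∀ᵐ ω ∂P, (Φ' ω).1 = Measure.sum (fun i : Index (Φ ω) =>
      Measure.dirac (displace Y₁ Y₂ (Φ ω) (X i ω) (V i ω))))

/-- Local square-integrability: `E[Φ(B)^2] < ∞` for all bounded Borel sets `B`. -/
def LocallySquareIntegrable {Ω : Type*} [MeasurableSpace Ω] (P : Measure Ω) {d : ℕ}
    (Φ : Ω → PointMeasure d) : Prop :=
  ∀ B : Set (EuclideanSpace ℝ (Fin d)), MeasurableSet B → Bornology.IsBounded B →
    MemLp (fun ω => ((Φ ω).1 B).toReal) 2 P

/-- The asymptotic variance `lim_{r → ∞} Var[Φ(B_r)] / volume(B_r)` exists and equals `s`. -/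
def HasAsymptoticVariance {Ω : Type*} [MeasurableSpace Ω] (P : Measure Ω) {d : ℕ}
    (Φ : Ω → PointMeasure d) (s : ℝ) : Prop :=
  Tendsto (fun r : ℝ =>
    (volume (closedBall (0 : EuclideanSpace ℝ (Fin d)) r)).toReal⁻¹ *
      variance (fun ω => ((Φ ω).1 (closedBall 0 r)).toReal) P) atTop (𝓝 s)

/-- Hyperuniformity: the asymptotic variance vanishes. -/
def IsHyperuniform {Ω : Type*} [MeasurableSpace Ω] (P : Measure Ω) {d : ℕ}
    (Φ : Ω → PointMeasure d) : Prop :=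
  HasAsymptoticVariance P Φ 0

end RandomOrganization

end

open MeasureTheory ProbabilityTheory Filter Topology Metric
open scoped NNReal ENNReal

noncomputable section

/-! One update moves every point by at most 2, so the number of points in a large ball changes only
through points near its boundary, and these contribute only to boundary order. Let N and N' be the
numbers of points in `closedBall 0 r` before and after an update, and let S be the mean of N' given
the old configuration (`condMean`). The variance of N' is the variance of S plus the mean
conditional variance of N'. Given the old configuration, N' is a sum of independent indicators with
success probabilities p, so its conditional variance is the sum of p(1 - p); this vanishes off a
shell around the sphere (`abs_variance_sub_variance_condMean_le`).

Moreover S = N + W, where W is a sum of local terms `meanChange` over the unit cubes that meet the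
shell. Terms of distant cubes are uncorrelated, so the variance of W is bounded by a constant times
the number of these cubes (`variance_sum_meanChange_le`). By Cauchy-Schwarz the covariance of N and
W is at most the square root of Var N times a boundary term, which is of smaller order than the
volume once Var N is of volume order. Hence the asymptotic variance is preserved
(`exists_abs_variance_sub_le`, `HasAsymptoticVariance.of_abs_sub_le`).

That distant cubes are uncorrelated needs a finite range of dependence at every step. Averaging the
noise out of the Laplace functional of the new process leaves a functional of the old one that looks
only a bounded distance further. So independence of separated regions survives an update, with the
range enlarged by 8 (`HasFiniteRange.update`). The Poisson process has range 0, and induction over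
the steps concludes. -/

namespace RandomOrganization

/-! ### Configurations: measurability, and locality of the displacement. -/

section

/-- The Euclidean space in which the points live. -/
abbrev Space (d : ℕ) : Type := EuclideanSpace ℝ (Fin d)

variable {d : ℕ}

instance (φ : PointMeasure d) : IsLocallyFiniteMeasure φ.1 := φ.2.1

theorem measure_lt_top_of_isBounded (φ : PointMeasure d) {A : Set (Space d)}
    (hA : Bornology.IsBounded A) : φ.1 A < ∞ :=
  hA.measure_lt_top

/-- The restriction of a configuration to a measurable set. -/
def restrictTo (A : Set (Space d)) (hA : MeasurableSet A) (φ : PointMeasure d) : PointMeasure d :=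
  ⟨φ.1.restrict A, inferInstance, fun B hB => by
    rw [Measure.restrict_apply hB]
    exact φ.2.2 _ (hB.inter hA)⟩

@[simp]
theorem restrictTo_coe (A : Set (Space d)) (hA : MeasurableSet A) (φ : PointMeasure d) :
    (restrictTo A hA φ).1 = φ.1.restrict A := rfl

theorem measurable_eval {B : Set (Space d)} (hB : MeasurableSet B) :
    Measurable (fun φ : PointMeasure d => φ.1 B) :=
  (Measure.measurable_coe hB).comp measurable_subtype_coe

theorem measurable_pointMeasure_iff {α : Type*} [MeasurableSpace α] {F : α → PointMeasure d} :
    Measurable F ↔ ∀ B, MeasurableSet B → Measurable (fun a => (F a).1 B) := by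
  refine ⟨fun h B hB => (measurable_eval hB).comp h, fun h => ?_⟩
  have : Measurable (fun a => (F a).1) := Measure.measurable_of_measurable_coe _ h
  exact this.subtype_mk (p := IsPointMeasure) (h := fun a => (F a).2)

theorem measurable_restrictTo (A : Set (Space d)) (hA : MeasurableSet A) :
    Measurable (restrictTo A hA) := by
  refine measurable_pointMeasure_iff.2 fun B hB => ?_
  simp only [restrictTo_coe, Measure.restrict_apply hB]
  exact measurable_eval (hB.inter hA)

/-- The tautological kernel from configurations to points. -/
def pointKernel (d : ℕ) : Kernel (PointMeasure d) (Space d) :=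
  ⟨Subtype.val, measurable_subtype_coe⟩

/-- Slicing the source by the integer part of the total mass makes each piece uniformly bounded. -/
theorem isSFiniteKernel_of_isFiniteMeasure {α β : Type*} [MeasurableSpace α] [MeasurableSpace β]
    (κ : Kernel α β) [∀ a, IsFiniteMeasure (κ a)] : IsSFiniteKernel κ := by
  classical
  have hm : Measurable fun a => κ a Set.univ := κ.measurable_coe MeasurableSet.univ
  let s : ℕ → Set α := fun m => {a | ⌊(κ a Set.univ).toReal⌋₊ = m}
  have hs : ∀ m, MeasurableSet (s m) := fun m =>
    (Nat.measurable_floor.comp hm.ennreal_toReal) (measurableSet_singleton m)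
  let η : ℕ → Kernel α β := fun m => Kernel.piecewise (hs m) κ 0
  have hη : ∀ m, IsFiniteKernel (η m) := fun m => by
    refine ⟨⟨m + 1, by finiteness, fun a => ?_⟩⟩
    simp only [η, Kernel.piecewise_apply]
    split_ifs with h
    · have h1 := Nat.lt_floor_add_one (κ a Set.univ).toReal
      rw [show ⌊(κ a Set.univ).toReal⌋₊ = m from h] at h1
      rw [← ENNReal.ofReal_toReal (measure_ne_top (κ a) Set.univ)]
      refine (ENNReal.ofReal_le_ofReal h1.le).trans ?_
      rw [ENNReal.ofReal_add (by positivity) zero_le_one]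
      simp
    · simp
  have : κ = Kernel.sum η := by
    ext a t ht
    rw [Kernel.sum_apply' _ _ ht, tsum_eq_single ⌊(κ a Set.univ).toReal⌋₊]
    · simp [η, s, Kernel.piecewise_apply]
    · intro m hm
      have : a ∉ s m := fun h => hm h.symm
      simp [η, Kernel.piecewise_apply, this]
  rw [this]
  infer_instance

/-- This makes integrals against a configuration measurable in the configuration. Local finiteness
gives finite mass on each of countably many disjoint annuli. -/
instance : IsSFiniteKernel (pointKernel d) := by
  let A : ℕ → Set (Space d) := disjointed fun n : ℕ => closedBall 0 n
  have hA : ∀ n, MeasurableSet (A n) := fun n =>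
    MeasurableSet.disjointed (fun _ => measurableSet_closedBall) n
  have hfin : ∀ n, IsSFiniteKernel ((pointKernel d).restrict (hA n)) := fun n => by
    have : ∀ φ, IsFiniteMeasure ((pointKernel d).restrict (hA n) φ) := fun φ => by
      refine ⟨?_⟩
      rw [Kernel.restrict_apply, Measure.restrict_apply_univ]
      exact measure_lt_top_of_isBounded φ (isBounded_closedBall.subset (disjointed_subset _ n))
    exact isSFiniteKernel_of_isFiniteMeasure _
  have : pointKernel d = Kernel.sum fun n => (pointKernel d).restrict (hA n) := by
    ext φ t ht
    simp_rw [Kernel.sum_apply' _ _ ht, Kernel.restrict_apply' _ _ _ ht]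
    rw [← measure_iUnion
      (fun i j hij => ((disjoint_disjointed _ hij).inter_left' _).inter_right' _)
      fun n => ht.inter (hA n),
      ← Set.inter_iUnion, iUnion_disjointed, iUnion_closedBall_nat, Set.inter_univ]
  rw [this]
  infer_instance

theorem measurable_lintegral_pointMeasure {f : PointMeasure d × Space d → ℝ≥0∞}
    (hf : Measurable f) : Measurable fun φ : PointMeasure d => ∫⁻ x, f (φ, x) ∂φ.1 :=
  hf.lintegral_kernel_prod_right' (κ := pointKernel d)

theorem measurable_shift :
    Measurable fun q : PointMeasure d × Space d => shift q.1 q.2 := by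
  refine measurable_pointMeasure_iff.2 fun B hB => ?_
  have hm : ∀ x : Space d, Measurable (fun y : Space d => y - x) := fun x => by fun_prop
  have hset : MeasurableSet {p : (PointMeasure d × Space d) × Space d | p.2 - p.1.2 ∈ B} :=
    (by fun_prop : Measurable fun p : (PointMeasure d × Space d) × Space d => p.2 - p.1.2) hB
  have := Kernel.measurable_kernel_prodMk_left
    (κ := (pointKernel d).comap (Prod.fst : PointMeasure d × Space d → _) measurable_fst) hset
  convert this using 2 with q
  rw [shift, Measure.map_apply (hm _) hB, Kernel.comap_apply]
  rfl

theorem measurable_displace {Y₁ : PointMeasure d → ({0, 1} : Set ℝ)}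
    {Y₂ : PointMeasure d → UnitBall d} (hY₁ : Measurable Y₁) (hY₂ : Measurable Y₂) :
    Measurable fun q : (PointMeasure d × Space d) × UnitBall d =>
      displace Y₁ Y₂ q.1.1 q.1.2 q.2 := by
  have hs : Measurable fun q : (PointMeasure d × Space d) × UnitBall d => shift q.1.1 q.1.2 :=
    measurable_shift.comp measurable_fst
  have h1 := (measurable_subtype_coe.comp (hY₁.comp hs))
  have h2 := (measurable_subtype_coe.comp (hY₂.comp hs))
  have h3 : Measurable fun q : (PointMeasure d × Space d) × UnitBall d => (q.2 : Space d) :=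
    measurable_subtype_coe.comp measurable_snd
  exact (measurable_snd.comp measurable_fst).add (h1.smul (h2.add h3))

theorem dist_displace_le (Y₁ : PointMeasure d → ({0, 1} : Set ℝ))
    (Y₂ : PointMeasure d → UnitBall d) (φ : PointMeasure d) (x : Space d) (u : UnitBall d) :
    dist (displace Y₁ Y₂ φ x u) x ≤ 2 := by
  have h1 : ‖(Y₁ (shift φ x) : ℝ)‖ ≤ 1 := by
    rcases (Y₁ (shift φ x)).2 with h | h
    · simp [h]
    · rw [Set.mem_singleton_iff.1 h]; simp
  have h2 : ‖(Y₂ (shift φ x) : Space d)‖ ≤ 1 := mem_closedBall_zero_iff.1 (Y₂ (shift φ x)).2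
  have h3 : ‖(u : Space d)‖ ≤ 1 := mem_closedBall_zero_iff.1 u.2
  rw [displace, dist_eq_norm, add_sub_cancel_left, norm_smul]
  have h4 := (norm_add_le _ _).trans (add_le_add h2 h3)
  nlinarith [norm_nonneg (Y₁ (shift φ x) : ℝ), norm_nonneg ((Y₂ (shift φ x) : Space d) + u)]

/-- By locality, the move of `x` depends on `φ` only through its points in `closedBall x 1`. -/
theorem displace_restrictTo {Y₁ : PointMeasure d → ({0, 1} : Set ℝ)}
    {Y₂ : PointMeasure d → UnitBall d} (hY₁ : IsLocal Y₁) (hY₂ : IsLocal Y₂)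
    {A : Set (Space d)} (hA : MeasurableSet A) (φ : PointMeasure d) {x : Space d}
    (hx : closedBall x 1 ⊆ A) (u : UnitBall d) :
    displace Y₁ Y₂ (restrictTo A hA φ) x u = displace Y₁ Y₂ φ x u := by
  have key : restrictUnitBall (shift (restrictTo A hA φ) x) = restrictUnitBall (shift φ x) := by
    refine Subtype.ext (Measure.ext fun B hB => ?_)
    have hm : Measurable (fun y : Space d => y - x) := by fun_prop
    have hB' : MeasurableSet (B ∩ closedBall 0 1) := hB.inter measurableSet_closedBall
    simp only [restrictUnitBall, shift, restrictTo_coe]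
    rw [Measure.restrict_apply hB, Measure.restrict_apply hB, Measure.map_apply hm hB',
      Measure.map_apply hm hB', Measure.restrict_apply (hm hB'), Set.inter_eq_left.2]
    intro y hy
    refine hx ?_
    have := hy.2
    rwa [mem_closedBall_zero_iff, ← dist_eq_norm] at this
  simp only [displace]
  rw [hY₁ (shift (restrictTo A hA φ) x), hY₂ (shift (restrictTo A hA φ) x), key, ← hY₁, ← hY₂]

end

/-! ### Independence of restrictions from factorising Laplace functionals. -/

section

variable {d : ℕ}

theorem aeval_boundedContinuousFunction_apply {E ι : Type*} [TopologicalSpace E]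
    (c : ι → BoundedContinuousFunction E ℝ) (p : MvPolynomial ι ℝ) (x : E) :
    (MvPolynomial.aeval c p : BoundedContinuousFunction E ℝ) x =
      MvPolynomial.aeval (fun i => c i x) p := by
  induction p using MvPolynomial.induction_on with
  | C a => simp [Algebra.algebraMap_eq_smul_one]
  | add p q hp hq => simp [hp, hq]
  | mul_X p i hp => simp [hp]

/-- Finite measures on a finite power of the unit interval are determined by their moments. -/
theorem ext_of_integral_prod_pow_eq {ι : Type*} [Fintype ι] {μ ν : Measure (ι → unitInterval)}
    [IsFiniteMeasure μ] [IsFiniteMeasure ν]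
    (h : ∀ m : ι → ℕ, ∫ x, ∏ i, (x i : ℝ) ^ m i ∂μ = ∫ x, ∏ i, (x i : ℝ) ^ m i ∂ν) : μ = ν := by
  let c : ι → BoundedContinuousFunction (ι → unitInterval) ℝ := fun i =>
    BoundedContinuousFunction.mkOfCompact ⟨fun x => (x i : ℝ), by fun_prop⟩
  -- Polynomials in the coordinates separate points, and such an algebra of bounded continuous
  -- functions determines a finite measure. The star is trivial over `ℝ`.
  let A : StarSubalgebra ℝ (BoundedContinuousFunction (ι → unitInterval) ℝ) :=
    { Algebra.adjoin ℝ (Set.range c) with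
      star_mem' := fun {a} ha => by
        have : star a = a := by ext x; simp
        rw [this]; exact ha }
  have hcA : ∀ i, c i ∈ A := fun i => Algebra.subset_adjoin ⟨i, rfl⟩
  refine ext_of_forall_mem_subalgebra_integral_eq_of_polish (𝕜 := ℝ) (A := A) ?_ ?_
  · intro x y hxy
    obtain ⟨i, hi⟩ := Function.ne_iff.1 hxy
    exact ⟨c i, ⟨_, ⟨c i, hcA i, rfl⟩, rfl⟩, fun h => hi (Subtype.ext h)⟩
  · intro g hg
    have hg' : g ∈ Algebra.adjoin ℝ (Set.range c) := hg
    rw [Algebra.adjoin_range_eq_range_aeval] at hg'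
    obtain ⟨p, rfl⟩ := hg'
    clear hg
    change ∫ x, (MvPolynomial.aeval c p : BoundedContinuousFunction _ ℝ) x ∂μ
      = ∫ x, (MvPolynomial.aeval c p : BoundedContinuousFunction _ ℝ) x ∂ν
    induction p using MvPolynomial.induction_on' with
    | monomial m a =>
      simp_rw [aeval_boundedContinuousFunction_apply, MvPolynomial.aeval_monomial,
        integral_const_mul]
      congr 1
      simpa [Finsupp.prod_fintype, c] using h m
    | add p q hp hq =>
      simp only [map_add, BoundedContinuousFunction.coe_add, Pi.add_apply]
      rw [integral_add (BoundedContinuousFunction.integrable _ _)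
        (BoundedContinuousFunction.integrable _ _),
        integral_add (BoundedContinuousFunction.integrable _ _)
        (BoundedContinuousFunction.integrable _ _), hp, hq]

theorem measurable_prod_pow {U : Type*} [Fintype U] (m : U → ℕ) :
    Measurable fun x : U → unitInterval => ∏ s, (x s : ℝ) ^ m s :=
  Finset.measurable_prod _ fun s _ =>
    (measurable_subtype_coe.comp (measurable_pi_apply s)).pow_const _

/-- Viewed on the cube indexed by `S ⊕ T`, the joint law and the product of the marginals have the
same mixed moments. -/
theorem indepFun_pi_of_moments {Ω S T : Type*} [MeasurableSpace Ω] {P : Measure Ω}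
    [IsProbabilityMeasure P] [Fintype S] [Fintype T] {X : S → Ω → unitInterval}
    {Y : T → Ω → unitInterval} (hX : ∀ s, Measurable (X s)) (hY : ∀ t, Measurable (Y t))
    (h : ∀ (m : S → ℕ) (n : T → ℕ),
      ∫ ω, (∏ s, (X s ω : ℝ) ^ m s) * ∏ t, (Y t ω : ℝ) ^ n t ∂P =
        (∫ ω, ∏ s, (X s ω : ℝ) ^ m s ∂P) * ∫ ω, ∏ t, (Y t ω : ℝ) ^ n t ∂P) :
    IndepFun (fun ω s => X s ω) (fun ω t => Y t ω) P := by
  have mX : Measurable fun ω s => X s ω := measurable_pi_lambda _ hX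
  have mY : Measurable fun ω t => Y t ω := measurable_pi_lambda _ hY
  rw [indepFun_iff_map_prod_eq_prod_map_map mX.aemeasurable mY.aemeasurable]
  have := Measure.isProbabilityMeasure_map (μ := P) mX.aemeasurable
  have := Measure.isProbabilityMeasure_map (μ := P) mY.aemeasurable
  let e := MeasurableEquiv.sumPiEquivProdPi (fun _ : S ⊕ T => unitInterval)
  have he : ∀ (q : (S → unitInterval) × (T → unitInterval)) (m : S ⊕ T → ℕ),
      ∏ i, (e.symm q i : ℝ) ^ m i =
        (∏ s, (q.1 s : ℝ) ^ m (.inl s)) * ∏ t, (q.2 t : ℝ) ^ m (.inr t) := fun q m => by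
    rw [Fintype.prod_sum_type]
    rfl
  refine e.symm.map_measurableEquiv_injective (ext_of_integral_prod_pow_eq fun m => ?_)
  rw [integral_map_equiv, integral_map_equiv]
  simp only [he]
  rw [integral_prod_mul (fun x : S → unitInterval => ∏ s, (x s : ℝ) ^ m (.inl s))
      (fun y : T → unitInterval => ∏ t, (y t : ℝ) ^ m (.inr t)),
    integral_map mX.aemeasurable (measurable_prod_pow _).aestronglyMeasurable,
    integral_map mY.aemeasurable (measurable_prod_pow _).aestronglyMeasurable]
  refine (integral_map (mX.prodMk mY).aemeasurable
    (((measurable_prod_pow _).comp measurable_fst).mul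
      ((measurable_prod_pow _).comp measurable_snd)).aestronglyMeasurable).trans ?_
  exact h _ _

/-- The function `t ↦ exp (-t)`. -/
def expNeg (t : ℝ≥0∞) : ℝ≥0∞ := ENNReal.ofReal (Real.exp (-t.toReal))

theorem measurable_expNeg : Measurable expNeg := by
  unfold expNeg
  fun_prop

theorem expNeg_le_one (t : ℝ≥0∞) : expNeg t ≤ 1 := by
  rw [expNeg, ENNReal.ofReal_le_one, Real.exp_le_one_iff]
  simp

theorem expNeg_zero : expNeg 0 = 1 := by simp [expNeg]

/-- Finiteness cannot be dropped: `toReal` sends `∞` to 0, so `expNeg ∞ = 1`. -/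
theorem expNeg_add {s t : ℝ≥0∞} (hs : s ≠ ∞) (ht : t ≠ ∞) :
    expNeg (s + t) = expNeg s * expNeg t := by
  rw [expNeg, ENNReal.toReal_add hs ht, neg_add, Real.exp_add,
    ENNReal.ofReal_mul (Real.exp_nonneg _)]
  rfl

theorem expNeg_sum {ι : Type*} (s : Finset ι) {t : ι → ℝ≥0∞} (ht : ∀ i ∈ s, t i ≠ ∞) :
    expNeg (∑ i ∈ s, t i) = ∏ i ∈ s, expNeg (t i) := by
  classical
  induction s using Finset.induction_on with
  | empty => simp [expNeg_zero]
  | insert a s ha ih =>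
    rw [Finset.sum_insert ha, Finset.prod_insert ha, expNeg_add (ht a (Finset.mem_insert_self _ _)),
      ih fun i hi => ht i (Finset.mem_insert_of_mem hi)]
    exact ENNReal.sum_ne_top.2 fun i hi => ht i (Finset.mem_insert_of_mem hi)

/-- The Laplace functional of the point process `Φ`. -/
def laplace {Ω : Type*} [MeasurableSpace Ω] (P : Measure Ω) (Φ : Ω → PointMeasure d)
    (f : Space d → ℝ≥0∞) : ℝ≥0∞ :=
  ∫⁻ ω, expNeg (∫⁻ x, f x ∂(Φ ω).1) ∂P

/-- A bounded measurable test function with values in `ℕ` that vanishes outside of `A`. -/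
structure IsTest (A : Set (Space d)) (f : Space d → ℕ) : Prop where
  measurable : Measurable f
  bounded : ∃ N, ∀ x, f x ≤ N
  support : ∀ x ∉ A, f x = 0

theorem IsTest.measurable_coe {A : Set (Space d)} {f : Space d → ℕ} (hf : IsTest A f) :
    Measurable fun x => (f x : ℝ≥0∞) :=
  measurable_from_nat.comp hf.measurable

/-- Integer combinations of indicators are enough as test functions: their Laplace functionals are
the mixed moments of the variables exp(-Φ(C)), which lie in the unit interval and so have laws
determined by moments. -/
theorem indepFun_restrictTo_of_laplace {Ω : Type*} [MeasurableSpace Ω] {P : Measure Ω}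
    [IsProbabilityMeasure P] {Φ : Ω → PointMeasure d} (hΦ : Measurable Φ)
    {A B : Set (Space d)} (hA : MeasurableSet A) (hB : MeasurableSet B)
    (hA' : Bornology.IsBounded A) (hB' : Bornology.IsBounded B)
    (h : ∀ f g : Space d → ℕ, IsTest A f → IsTest B g →
      laplace P Φ (fun x => f x + g x) =
        laplace P Φ (fun x => f x) * laplace P Φ (fun x => g x)) :
    IndepFun (fun ω => restrictTo A hA (Φ ω)) (fun ω => restrictTo B hB (Φ ω)) P := by
  let w : Set (Space d) → Ω → unitInterval := fun C ω =>
    ⟨Real.exp (-((Φ ω).1 C).toReal), (Real.exp_pos _).le, by simp⟩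
  have hw : ∀ C, MeasurableSet C → Measurable (w C) := fun C hC =>
    ((((measurable_eval hC).comp hΦ).ennreal_toReal.neg).exp).subtype_mk
  have hproc : IndepFun (fun ω (C : {C : Set (Space d) // MeasurableSet C}) => w (C.1 ∩ A) ω)
      (fun ω (C : {C : Set (Space d) // MeasurableSet C}) => w (C.1 ∩ B) ω) P := by
    refine IndepFun.process_indepFun_process (fun C => hw _ (C.2.inter hA))
      (fun C => hw _ (C.2.inter hB)) fun I J => ?_
    refine indepFun_pi_of_moments (fun s => hw _ (s.1.2.inter hA)) (fun t => hw _ (t.1.2.inter hB))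
      fun m n => ?_
    have test : ∀ {D : Set (Space d)} (hD : MeasurableSet D)
        (K : Finset {C : Set (Space d) // MeasurableSet C}) (m : K → ℕ),
        IsTest D (fun x => ∑ s : K, m s * (s.1.1 ∩ D).indicator (fun _ => 1) x) := by
      intro D hD K m
      refine ⟨?_, ⟨∑ s : K, m s * 1, fun x => ?_⟩, fun x hx => ?_⟩
      · exact Finset.measurable_sum _ fun s _ =>
          (measurable_const.indicator (s.1.2.inter hD)).const_mul _
      · gcongr with s
        exact Set.indicator_le_self' (fun _ _ => Nat.zero_le _) x
      · simp [hx]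
    have hint : ∀ {D : Set (Space d)} (hD : MeasurableSet D)
        (K : Finset {C : Set (Space d) // MeasurableSet C}) (m : K → ℕ) (ω : Ω),
        ∫⁻ x, ((∑ s : K, m s * (s.1.1 ∩ D).indicator (fun _ => 1) x : ℕ) : ℝ≥0∞) ∂(Φ ω).1 =
          ∑ s : K, m s * (Φ ω).1 (s.1.1 ∩ D) := by
      intro D hD K m ω
      have : ∀ x, ((∑ s : K, m s * (s.1.1 ∩ D).indicator (fun _ => 1) x : ℕ) : ℝ≥0∞) =
          ∑ s : K, (m s : ℝ≥0∞) * (s.1.1 ∩ D).indicator 1 x := fun x => by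
        push_cast
        refine Finset.sum_congr rfl fun s _ => ?_
        by_cases hx : x ∈ s.1.1 ∩ D <;> simp [hx]
      simp_rw [this]
      rw [lintegral_finsetSum _ fun s _ =>
        (measurable_one.indicator (s.1.2.inter hD)).const_mul _]
      refine Finset.sum_congr rfl fun s _ => ?_
      rw [lintegral_const_mul _ (measurable_one.indicator (s.1.2.inter hD)),
        lintegral_indicator_one (s.1.2.inter hD)]
    have hprod : ∀ {D : Set (Space d)} (hD : MeasurableSet D) (hD' : Bornology.IsBounded D)
        (K : Finset {C : Set (Space d) // MeasurableSet C}) (m : K → ℕ) (ω : Ω),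
        expNeg (∑ s : K, m s * (Φ ω).1 (s.1.1 ∩ D)) =
          ENNReal.ofReal (∏ s : K, (w (s.1.1 ∩ D) ω : ℝ) ^ m s) ∧
        ∑ s : K, m s * (Φ ω).1 (s.1.1 ∩ D) ≠ ∞ := by
      intro D hD hD' K m ω
      have hfin : ∀ s : K, (Φ ω).1 (s.1.1 ∩ D) ≠ ∞ := fun s =>
        (measure_lt_top_of_isBounded _ (hD'.subset Set.inter_subset_right)).ne
      have hfin' : ∀ s ∈ (Finset.univ : Finset K), m s * (Φ ω).1 (s.1.1 ∩ D) ≠ ∞ := fun s _ =>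
        ENNReal.mul_ne_top (by simp) (hfin s)
      refine ⟨?_, ENNReal.sum_ne_top.2 hfin'⟩
      rw [expNeg_sum _ hfin', ENNReal.ofReal_prod_of_nonneg fun s _ => pow_nonneg (w _ ω).2.1 _]
      refine Finset.prod_congr rfl fun s _ => ?_
      rw [expNeg, ENNReal.toReal_mul, ENNReal.toReal_natCast, ← Real.exp_nat_mul]
      simp
    have := h _ _ (test hA I m) (test hB J n)
    simp only [laplace] at this
    have hadd : ∀ ω, ∫⁻ x, ((∑ s : I, m s * (s.1.1 ∩ A).indicator (fun _ => 1) x : ℕ) : ℝ≥0∞) +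
          ((∑ s : J, n s * (s.1.1 ∩ B).indicator (fun _ => 1) x : ℕ) : ℝ≥0∞) ∂(Φ ω).1 =
        ∑ s : I, m s * (Φ ω).1 (s.1.1 ∩ A) + ∑ s : J, n s * (Φ ω).1 (s.1.1 ∩ B) := fun ω => by
      refine (lintegral_add_left (test hA I m).measurable_coe _).trans ?_
      rw [hint hA, hint hB]
    simp_rw [hadd, hint hA, hint hB] at this
    simp_rw [fun ω => expNeg_add (hprod hA hA' I m ω).2 (hprod hB hB' J n ω).2,
      fun ω => (hprod hA hA' I m ω).1, fun ω => (hprod hB hB' J n ω).1] at this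
    have nonneg : ∀ (D : Set (Space d)) (K : Finset {C : Set (Space d) // MeasurableSet C})
        (m : K → ℕ) (ω : Ω), 0 ≤ ∏ s : K, (w (s.1.1 ∩ D) ω : ℝ) ^ m s := fun D K m ω =>
      Finset.prod_nonneg fun s _ => pow_nonneg (w _ ω).2.1 _
    have meas : ∀ {D : Set (Space d)} (hD : MeasurableSet D)
        (K : Finset {C : Set (Space d) // MeasurableSet C}) (m : K → ℕ),
        Measurable fun ω => ∏ s : K, (w (s.1.1 ∩ D) ω : ℝ) ^ m s := fun hD K m =>
      Finset.measurable_prod _ fun s _ =>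
        (measurable_subtype_coe.comp (hw _ (s.1.2.inter hD))).pow_const _
    rw [integral_eq_lintegral_of_nonneg_ae
        (.of_forall fun ω => mul_nonneg (nonneg A I m ω) (nonneg B J n ω))
        ((meas hA I m).mul (meas hB J n)).aestronglyMeasurable,
      integral_eq_lintegral_of_nonneg_ae (.of_forall fun ω => nonneg A I m ω)
        (meas hA I m).aestronglyMeasurable,
      integral_eq_lintegral_of_nonneg_ae (.of_forall fun ω => nonneg B J n ω)
        (meas hB J n).aestronglyMeasurable, ← ENNReal.toReal_mul, ← this]
    simp_rw [fun ω => ENNReal.ofReal_mul (q := ∏ s : J, (w (s.1.1 ∩ B) ω : ℝ) ^ n s)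
      (nonneg A I m ω)]
  -- Counts in bounded sets are finite, so -log recovers them from `w`, and passing to `w` loses no
  -- information.
  have hle : ∀ {D : Set (Space d)} (hD : MeasurableSet D), Bornology.IsBounded D →
      MeasurableSpace.comap (fun ω => restrictTo D hD (Φ ω)) inferInstance ≤
      MeasurableSpace.comap
        (fun ω (C : {C : Set (Space d) // MeasurableSet C}) => w (C.1 ∩ D) ω) inferInstance := by
    intro D hD hD'
    rw [← measurable_iff_comap_le]
    refine (@measurable_pointMeasure_iff _ _ (_) _).2 fun C hC => ?_
    have h1 : Measurable[MeasurableSpace.comap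
        (fun ω (C : {C : Set (Space d) // MeasurableSet C}) => w (C.1 ∩ D) ω) inferInstance]
        (w (C ∩ D)) :=
      (measurable_pi_apply (⟨C, hC⟩ : {C : Set (Space d) // MeasurableSet C})).comp
        (comap_measurable
          (fun ω (C : {C : Set (Space d) // MeasurableSet C}) => w (C.1 ∩ D) ω))
    have h2 : (fun ω => (restrictTo D hD (Φ ω)).1 C) =
        (fun u : unitInterval => ENNReal.ofReal (-Real.log u)) ∘ w (C ∩ D) := by
      funext ω
      rw [restrictTo_coe, Measure.restrict_apply hC]
      simp only [Function.comp, w, Real.log_exp, neg_neg]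
      rw [ENNReal.ofReal_toReal]
      exact (measure_lt_top_of_isBounded _ (hD'.subset Set.inter_subset_right)).ne
    rw [h2]
    exact (by fun_prop : Measurable fun u : unitInterval => ENNReal.ofReal (-Real.log u)).comp h1
  exact indep_of_indep_of_le_left (indep_of_indep_of_le_right hproc (hle hB hB')) (hle hA hA')

end

/-! ### The conditional Laplace functional of an update, and finite range of dependence. -/

section

variable {d : ℕ}

/-- The points of the configuration `φ` are listed by the sequence `x`. -/
def IsListing (φ : PointMeasure d) (x : ℕ → Space d) : Prop :=
  φ.1 = Measure.sum fun i : Index φ => Measure.dirac (x i)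

theorem lintegral_of_eq_sum_dirac {ι : Type*} {μ : Measure (Space d)} {z : ι → Space d}
    (h : μ = Measure.sum fun i => Measure.dirac (z i)) {f : Space d → ℝ≥0∞} (hf : Measurable f) :
    ∫⁻ y, f y ∂μ = ∑' i, f (z i) := by
  rw [h, lintegral_sum_measure]
  simp_rw [lintegral_dirac' _ hf]

theorem IsListing.finite {φ : PointMeasure d} {x : ℕ → Space d} (h : IsListing φ x)
    {A : Set (Space d)} (hA : MeasurableSet A) (hA' : Bornology.IsBounded A) :
    {i : Index φ | x i ∈ A}.Finite := by
  have h1 : ∑' i : Index φ, A.indicator (1 : Space d → ℝ≥0∞) (x i) ≠ ∞ := by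
    rw [← lintegral_of_eq_sum_dirac h (measurable_one.indicator hA), lintegral_indicator_one hA]
    exact (measure_lt_top_of_isBounded φ hA').ne
  refine (ENNReal.finite_const_le_of_tsum_ne_top h1 one_ne_zero).subset fun i hi => ?_
  simp [Set.indicator_of_mem (show x i ∈ A from hi)]

/-- The index type varies with the configuration; indicators turn the sum into one over the fixed
set `ℕ`. -/
theorem measurable_tsum_index {α : Type*} [MeasurableSpace α] {F : α → PointMeasure d}
    (hF : Measurable F) {a : ℕ → α → ℝ≥0∞} (ha : ∀ i, Measurable (a i)) :
    Measurable fun y => ∑' i : Index (F y), a i y := by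
  have : (fun y => ∑' i : Index (F y), a i y) =
      fun y => ∑' i : ℕ, {y | (i : ℝ≥0∞) < (F y).1 Set.univ}.indicator (a i) y := by
    funext y
    rw [show ∑' i : Index (F y), a i y = ∑' i : ℕ,
      {i : ℕ | (i : ℝ≥0∞) < (F y).1 Set.univ}.indicator (fun i => a i y) i from
      tsum_subtype {i : ℕ | (i : ℝ≥0∞) < (F y).1 Set.univ} fun i => a i y]
    rfl
  rw [this]
  exact Measurable.tsum fun i => (ha i).indicator
    (measurableSet_lt measurable_const ((measurable_eval MeasurableSet.univ).comp hF))

theorem lintegral_comp_of_indepFun {Ω α β : Type*} [MeasurableSpace Ω] [MeasurableSpace α]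
    [MeasurableSpace β] {P : Measure Ω} [IsProbabilityMeasure P] {F : Ω → α} {W : Ω → β}
    (hF : Measurable F) (hW : Measurable W) (h : IndepFun F W P) {G : α × β → ℝ≥0∞}
    (hG : Measurable G) :
    ∫⁻ ω, G (F ω, W ω) ∂P = ∫⁻ ω, ∫⁻ ω', G (F ω, W ω') ∂P ∂P := by
  have := Measure.isProbabilityMeasure_map (μ := P) hW.aemeasurable
  rw [← lintegral_map (f := G) hG (hF.prodMk hW),
    (indepFun_iff_map_prod_eq_prod_map_map hF.aemeasurable hW.aemeasurable).1 h,
    lintegral_prod _ hG.aemeasurable, lintegral_map hG.lintegral_prod_right' hF]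
  exact lintegral_congr fun ω => lintegral_map (hG.comp measurable_prodMk_left) hW

variable {Ω : Type*} [MeasurableSpace Ω] {P : Measure Ω} [IsProbabilityMeasure P]
  {Y₁ : PointMeasure d → ({0, 1} : Set ℝ)} {Y₂ : PointMeasure d → UnitBall d}
  {V : ℕ → Ω → UnitBall d} {Φ Φ' : Ω → PointMeasure d} {ν : Measure (UnitBall d)}

/-- Conditionally on the old configuration and its listing, the noise is still distributed as
before. -/
theorem IsUpdate.exists_listing (h : IsUpdate P Y₁ Y₂ V Φ Φ') (hY₁ : Measurable Y₁)
    (hY₂ : Measurable Y₂) (hV : ∀ i, Measurable (V i)) (hΦ : Measurable Φ) :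
    ∃ X : Ω → ℕ → Space d, (∀ᵐ ω ∂P, IsListing (Φ ω) (X ω)) ∧
      ∀ (H : ℝ≥0∞ → ℝ≥0∞) (f : Space d → ℝ≥0∞), Measurable H → Measurable f →
        ∫⁻ ω, H (∫⁻ y, f y ∂(Φ' ω).1) ∂P =
          ∫⁻ ω, ∫⁻ ω', H (∑' i : Index (Φ ω), f (displace Y₁ Y₂ (Φ ω) (X ω i) (V i ω'))) ∂P ∂P := by
  obtain ⟨X, hX, hind, hlist, hnew⟩ := h
  refine ⟨fun ω i => X i ω, hlist, fun H f hH hf => ?_⟩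
  have hG : Measurable fun q : (PointMeasure d × (ℕ → Space d)) × (ℕ → UnitBall d) =>
      H (∑' i : Index q.1.1, f (displace Y₁ Y₂ q.1.1 (q.1.2 i) (q.2 i))) := by
    refine hH.comp (measurable_tsum_index
      (F := fun q : (PointMeasure d × (ℕ → Space d)) × (ℕ → UnitBall d) => q.1.1)
      (a := fun i q => f (displace Y₁ Y₂ q.1.1 (q.1.2 i) (q.2 i)))
      (measurable_fst.comp measurable_fst) fun i => ?_)
    refine hf.comp ((measurable_displace hY₁ hY₂).comp
      (f := fun q : (PointMeasure d × (ℕ → Space d)) × (ℕ → UnitBall d) =>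
        ((q.1.1, q.1.2 i), q.2 i)) ?_)
    fun_prop
  have := lintegral_comp_of_indepFun (hΦ.prodMk (measurable_pi_lambda _ hX))
    (measurable_pi_lambda _ hV) hind hG
  rw [← this]
  refine lintegral_congr_ae (hnew.mono fun ω hω => ?_)
  simp only
  rw [lintegral_of_eq_sum_dirac hω hf]

/-- The mean of `f` at the new position of the point `x` of the configuration `φ`. -/
def meanDisplace (ν : Measure (UnitBall d)) (Y₁ : PointMeasure d → ({0, 1} : Set ℝ))
    (Y₂ : PointMeasure d → UnitBall d) (f : Space d → ℝ≥0∞) (φ : PointMeasure d) (x : Space d) :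
    ℝ≥0∞ :=
  ∫⁻ u, f (displace Y₁ Y₂ φ x u) ∂ν

theorem measurable_displace_right (hY₁ : Measurable Y₁) (hY₂ : Measurable Y₂)
    (φ : PointMeasure d) (x : Space d) : Measurable (displace Y₁ Y₂ φ x) :=
  (measurable_displace hY₁ hY₂).comp (measurable_prodMk_left (x := (φ, x)))

theorem measurable_meanDisplace [SFinite ν] (hY₁ : Measurable Y₁) (hY₂ : Measurable Y₂)
    {f : Space d → ℝ≥0∞} (hf : Measurable f) :
    Measurable fun q : PointMeasure d × Space d => meanDisplace ν Y₁ Y₂ f q.1 q.2 :=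
  (hf.comp (measurable_displace hY₁ hY₂)).lintegral_prod_right'

omit [IsProbabilityMeasure P] in
theorem lintegral_displace (hY₁ : Measurable Y₁) (hY₂ : Measurable Y₂) {W : Ω → UnitBall d}
    (hW : Measurable W) (hν : P.map W = ν) {f : Space d → ℝ≥0∞} (hf : Measurable f)
    (φ : PointMeasure d) (x : Space d) :
    ∫⁻ ω, f (displace Y₁ Y₂ φ x (W ω)) ∂P = meanDisplace ν Y₁ Y₂ f φ x := by
  rw [meanDisplace, ← hν]
  exact (lintegral_map (hf.comp (measurable_displace_right hY₁ hY₂ φ x)) hW).symm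

theorem meanDisplace_restrictTo (hY₁ : IsLocal Y₁) (hY₂ : IsLocal Y₂)
    {A : Set (Space d)} (hA : MeasurableSet A) (f : Space d → ℝ≥0∞) (φ : PointMeasure d)
    {x : Space d} (hx : closedBall x 1 ⊆ A) :
    meanDisplace ν Y₁ Y₂ f (restrictTo A hA φ) x = meanDisplace ν Y₁ Y₂ f φ x := by
  simp only [meanDisplace, displace_restrictTo hY₁ hY₂ hA φ hx]

theorem meanDisplace_congr {f g : Space d → ℝ≥0∞} {x : Space d}
    (h : ∀ y, dist y x ≤ 2 → f y = g y) (φ : PointMeasure d) :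
    meanDisplace ν Y₁ Y₂ f φ x = meanDisplace ν Y₁ Y₂ g φ x :=
  lintegral_congr fun _ => h _ (dist_displace_le _ _ _ _ _)

theorem meanDisplace_const [IsProbabilityMeasure ν] (c : ℝ≥0∞) (φ : PointMeasure d)
    (x : Space d) : meanDisplace ν Y₁ Y₂ (fun _ => c) φ x = c := by
  simp [meanDisplace]

/-- The exponent that the test function `f` has on average after one displacement. -/
def pullback (ν : Measure (UnitBall d)) (Y₁ : PointMeasure d → ({0, 1} : Set ℝ))
    (Y₂ : PointMeasure d → UnitBall d) (f : Space d → ℕ) (φ : PointMeasure d) (x : Space d) :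
    ℝ≥0∞ :=
  ENNReal.ofReal (-Real.log (meanDisplace ν Y₁ Y₂ (fun y => expNeg (f y)) φ x).toReal)

theorem IsTest.measurable_expNeg {A : Set (Space d)} {f : Space d → ℕ} (hf : IsTest A f) :
    Measurable fun y => expNeg (f y) :=
  RandomOrganization.measurable_expNeg.comp hf.measurable_coe

theorem measurable_pullback [SFinite ν] (hY₁ : Measurable Y₁) (hY₂ : Measurable Y₂)
    {A : Set (Space d)} {f : Space d → ℕ} (hf : IsTest A f) :
    Measurable fun q : PointMeasure d × Space d => pullback ν Y₁ Y₂ f q.1 q.2 :=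
  (measurable_meanDisplace hY₁ hY₂ hf.measurable_expNeg).ennreal_toReal.log.neg.ennreal_ofReal

theorem measurable_pullback_right [SFinite ν] (hY₁ : Measurable Y₁) (hY₂ : Measurable Y₂)
    {A : Set (Space d)} {f : Space d → ℕ} (hf : IsTest A f) (φ : PointMeasure d) :
    Measurable fun x => pullback ν Y₁ Y₂ f φ x := by
  have h := measurable_pullback (ν := ν) hY₁ hY₂ hf
  exact h.of_uncurry_left

theorem pullback_congr {f g : Space d → ℕ} {x : Space d}
    (h : ∀ y, dist y x ≤ 2 → f y = g y) (φ : PointMeasure d) :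
    pullback ν Y₁ Y₂ f φ x = pullback ν Y₁ Y₂ g φ x := by
  rw [pullback, meanDisplace_congr (g := fun y => expNeg (g y)) fun y hy => by rw [h y hy]]
  rfl

theorem pullback_eq_zero [IsProbabilityMeasure ν] {f : Space d → ℕ} {x : Space d}
    (h : ∀ y, dist y x ≤ 2 → f y = 0) (φ : PointMeasure d) :
    pullback ν Y₁ Y₂ f φ x = 0 := by
  rw [pullback_congr (g := fun _ => 0) h, pullback]
  simp [expNeg_zero, meanDisplace_const]

/-- Boundedness of `f` keeps the mean between exp(-N) and 1, so its logarithm takes no default value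
and `ENNReal.ofReal` truncates nothing. -/
theorem pullback_le [IsProbabilityMeasure ν] {f : Space d → ℕ} {N : ℕ} (hN : ∀ y, f y ≤ N)
    (φ : PointMeasure d) (x : Space d) :
    pullback ν Y₁ Y₂ f φ x ≤ N ∧
      expNeg (pullback ν Y₁ Y₂ f φ x) = meanDisplace ν Y₁ Y₂ (fun y => expNeg (f y)) φ x := by
  set Λ := meanDisplace ν Y₁ Y₂ (fun y => expNeg (f y)) φ x with hΛ
  have h1 : Λ ≤ 1 := by
    refine (lintegral_mono fun _ => expNeg_le_one _).trans ?_
    simp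
  have h2 : ENNReal.ofReal (Real.exp (-N)) ≤ Λ := by
    rw [← meanDisplace_const (ν := ν) (Y₁ := Y₁) (Y₂ := Y₂) (ENNReal.ofReal (Real.exp (-N))) φ x]
    refine lintegral_mono fun u => ENNReal.ofReal_le_ofReal (Real.exp_le_exp.2 ?_)
    simpa using hN _
  have hfin : Λ ≠ ∞ := (h1.trans_lt ENNReal.one_lt_top).ne
  have h2' : Real.exp (-N) ≤ Λ.toReal := (ENNReal.ofReal_le_iff_le_toReal hfin).1 h2
  have hpos : 0 < Λ.toReal := (Real.exp_pos _).trans_le h2'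
  have h1' : Λ.toReal ≤ 1 := ENNReal.toReal_le_of_le_ofReal zero_le_one (by simpa using h1)
  have hlog : 0 ≤ -Real.log Λ.toReal := neg_nonneg.2 (Real.log_nonpos hpos.le h1')
  constructor
  · rw [pullback, ← hΛ, ← ENNReal.ofReal_natCast]
    refine ENNReal.ofReal_le_ofReal ?_
    rw [neg_le, Real.le_log_iff_exp_le hpos]
    exact h2'
  · rw [pullback, ← hΛ, expNeg, ENNReal.toReal_ofReal hlog, neg_neg, Real.exp_log hpos,
      ENNReal.ofReal_toReal hfin]

/-- Thickenings are defined by a strict inequality; 3 leaves room above the maximal displacement 2.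
-/
theorem eq_zero_of_notMem_thickening {A : Set (Space d)} {f : Space d → ℕ} (hf : IsTest A f)
    {x : Space d} (hx : x ∉ thickening 3 A) (y : Space d) (hy : dist y x ≤ 2) : f y = 0 := by
  refine hf.support y fun hyA => hx (mem_thickening_iff.2 ⟨y, hyA, ?_⟩)
  rw [dist_comm]
  linarith

/-- The conditional Laplace functional of the new configuration, given the old one. -/
theorem lintegral_expNeg_tsum (hY₁ : Measurable Y₁) (hY₂ : Measurable Y₂)
    (hV : ∀ i, Measurable (V i)) (hVi : iIndepFun V P) (hν : ∀ i, P.map (V i) = ν)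
    {A : Set (Space d)} (hA : Bornology.IsBounded A) {f : Space d → ℕ} (hf : IsTest A f)
    {φ : PointMeasure d} {x : ℕ → Space d} (hx : IsListing φ x) :
    ∫⁻ ω, expNeg (∑' i : Index φ, (f (displace Y₁ Y₂ φ (x i) (V i ω)) : ℝ≥0∞)) ∂P =
      expNeg (∫⁻ y, pullback ν Y₁ Y₂ f φ y ∂φ.1) := by
  have : IsProbabilityMeasure ν := hν 0 ▸ Measure.isProbabilityMeasure_map (hV 0).aemeasurable
  obtain ⟨N, hN⟩ := hf.bounded
  -- Only these finitely many points can reach `A`, so independence is needed only for a finite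
  -- product.
  let J := (hx.finite isOpen_thickening.measurableSet (hA.thickening (δ := 3))).toFinset
  have hJ : ∀ i ∉ J, x i ∉ thickening 3 A := fun i hi h => hi (by simpa [J] using h)
  have h1 : ∀ ω, ∑' i : Index φ, (f (displace Y₁ Y₂ φ (x i) (V i ω)) : ℝ≥0∞) =
      ∑ i ∈ J, (f (displace Y₁ Y₂ φ (x i) (V i ω)) : ℝ≥0∞) := fun ω =>
    tsum_eq_sum fun i hi => by
      simp [eq_zero_of_notMem_thickening hf (hJ i hi) _ (dist_displace_le Y₁ Y₂ _ _ _)]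
  have hm : ∀ i : Index φ, Measurable fun u => expNeg (f (displace Y₁ Y₂ φ (x i) u)) := fun i =>
    hf.measurable_expNeg.comp (measurable_displace_right hY₁ hY₂ φ (x i))
  have hind : iIndepFun (fun (i : Index φ) ω => expNeg (f (displace Y₁ Y₂ φ (x i) (V i ω)))) P :=
    (hVi.precomp (g := fun i : Index φ => i.1) Subtype.val_injective).comp _ hm
  simp_rw [h1, fun ω => expNeg_sum J (t := fun i : Index φ =>
    (f (displace Y₁ Y₂ φ (x i) (V i ω)) : ℝ≥0∞)) fun i _ => by simp]
  rw [lintegral_prod_eq_prod_lintegral_of_indepFun J _ hind fun i => (hm i).comp (hV i),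
    lintegral_of_eq_sum_dirac hx (measurable_pullback_right hY₁ hY₂ hf _),
    tsum_eq_sum (s := J) fun i hi => pullback_eq_zero
      (eq_zero_of_notMem_thickening hf (hJ i hi)) φ, expNeg_sum J fun i _ =>
      ((pullback_le hN φ (x i)).1.trans_lt (by simp)).ne]
  refine Finset.prod_congr rfl fun i _ => ?_
  rw [(pullback_le hN φ (x i)).2,
    ← lintegral_displace hY₁ hY₂ (hV i) (hν i) hf.measurable_expNeg φ (x i)]

theorem IsUpdate.laplace_eq (h : IsUpdate P Y₁ Y₂ V Φ Φ') (hY₁ : Measurable Y₁)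
    (hY₂ : Measurable Y₂) (hV : ∀ i, Measurable (V i)) (hVi : iIndepFun V P)
    (hν : ∀ i, P.map (V i) = ν) (hΦ : Measurable Φ)
    {A : Set (Space d)} (hA : Bornology.IsBounded A) {f : Space d → ℕ} (hf : IsTest A f) :
    laplace P Φ' (fun x => f x) =
      ∫⁻ ω, expNeg (∫⁻ y, pullback ν Y₁ Y₂ f (Φ ω) y ∂(Φ ω).1) ∂P := by
  obtain ⟨X, hX, hH⟩ := h.exists_listing hY₁ hY₂ hV hΦ
  rw [laplace, hH _ _ measurable_expNeg hf.measurable_coe]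
  exact lintegral_congr_ae (hX.mono fun ω hω =>
    lintegral_expNeg_tsum hY₁ hY₂ hV hVi hν hA hf hω)

/-- Contributing points lie within 3 of `A`, and their moves look at configuration points at most 1
further away: hence the radius 4. -/
theorem lintegral_pullback_restrictTo [IsProbabilityMeasure ν] (hY₁ : IsLocal Y₁)
    (hY₂ : IsLocal Y₂) {A : Set (Space d)} {f : Space d → ℕ} (hf : IsTest A f)
    (φ : PointMeasure d) :
    ∫⁻ y, pullback ν Y₁ Y₂ f (restrictTo (thickening 4 A) isOpen_thickening.measurableSet φ) y
        ∂(restrictTo (thickening 4 A) isOpen_thickening.measurableSet φ).1 =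
      ∫⁻ y, pullback ν Y₁ Y₂ f φ y ∂φ.1 := by
  have h3 : ∀ x ∉ thickening 3 A, ∀ ψ : PointMeasure d, pullback ν Y₁ Y₂ f ψ x = 0 :=
    fun x hx => pullback_eq_zero (eq_zero_of_notMem_thickening hf hx)
  have h4 : ∀ x, pullback ν Y₁ Y₂ f
      (restrictTo (thickening 4 A) isOpen_thickening.measurableSet φ) x =
      pullback ν Y₁ Y₂ f φ x := fun x => by
    by_cases hx : x ∈ thickening 3 A
    · rw [pullback, meanDisplace_restrictTo hY₁ hY₂, pullback]
      intro y hy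
      obtain ⟨a, ha, hxa⟩ := mem_thickening_iff.1 hx
      refine mem_thickening_iff.2 ⟨a, ha, ?_⟩
      linarith [dist_triangle y x a, mem_closedBall.1 hy]
    · rw [h3 x hx, h3 x hx]
  simp_rw [h4, restrictTo_coe]
  rw [setLIntegral_eq_of_support_subset]
  intro x hx
  by_contra hx'
  exact hx (h3 x (fun h => hx' (thickening_mono (by norm_num) _ h)) φ)

/-- Restrictions of the point process to bounded sets of distance more than `R` are independent. -/
def HasFiniteRange (P : Measure Ω) (Φ : Ω → PointMeasure d) (R : ℝ) : Prop :=
  ∀ (A B : Set (Space d)) (hA : MeasurableSet A) (hB : MeasurableSet B),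
    Bornology.IsBounded A → Bornology.IsBounded B → (∀ a ∈ A, ∀ b ∈ B, R < dist a b) →
    IndepFun (fun ω => restrictTo A hA (Φ ω)) (fun ω => restrictTo B hB (Φ ω)) P

theorem IsTest.add {A B : Set (Space d)} {f g : Space d → ℕ} (hf : IsTest A f) (hg : IsTest B g) :
    IsTest (A ∪ B) fun x => f x + g x := by
  obtain ⟨M, hM⟩ := hf.bounded
  obtain ⟨N, hN⟩ := hg.bounded
  refine ⟨hf.measurable.add hg.measurable, ⟨M + N, fun x => add_le_add (hM x) (hN x)⟩,
    fun x hx => ?_⟩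
  rw [hf.support x fun h => hx (.inl h), hg.support x fun h => hx (.inr h)]

/-- The conditional Laplace functionals for `A` and `B` depend on the old process within 4 of each
set, so 8 = 4 + 4 is added to the range. No point can reach both sets, which makes the exponent
`pullback` additive in the two test functions. -/
theorem HasFiniteRange.update {R : ℝ} (hR : HasFiniteRange P Φ R) (hR0 : 0 ≤ R)
    (h : IsUpdate P Y₁ Y₂ V Φ Φ') (hY₁ : Measurable Y₁)
    (hY₂ : Measurable Y₂) (hY₁' : IsLocal Y₁) (hY₂' : IsLocal Y₂)
    (hV : ∀ i, Measurable (V i)) (hVi : iIndepFun V P)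
    (hν : ∀ i, P.map (V i) = ν) (hΦ : Measurable Φ) (hΦ' : Measurable Φ') :
    HasFiniteRange P Φ' (R + 8) := by
  have : IsProbabilityMeasure ν := hν 0 ▸ Measure.isProbabilityMeasure_map (hV 0).aemeasurable
  intro A B hA hB hA' hB' hAB
  refine indepFun_restrictTo_of_laplace hΦ' hA hB hA' hB' fun f g hf hg => ?_
  have hfar : ∀ x ∈ thickening 4 A, ∀ y ∈ thickening 4 B, R < dist x y := by
    intro x hx y hy
    obtain ⟨a, ha, hxa⟩ := mem_thickening_iff.1 hx
    obtain ⟨b, hb, hyb⟩ := mem_thickening_iff.1 hy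
    have := hAB a ha b hb
    have := dist_triangle4 a x y b
    rw [dist_comm a x] at this
    linarith
  have key := hR _ _ isOpen_thickening.measurableSet isOpen_thickening.measurableSet
    hA'.thickening hB'.thickening hfar
  have hmeas : ∀ {D : Set (Space d)} {f : Space d → ℕ}, IsTest D f →
      Measurable fun φ : PointMeasure d => expNeg (∫⁻ y, pullback ν Y₁ Y₂ f φ y ∂φ.1) :=
    fun hf => measurable_expNeg.comp
      (measurable_lintegral_pointMeasure (measurable_pullback hY₁ hY₂ hf))
  have hadd : ∀ φ x, pullback ν Y₁ Y₂ (fun x => f x + g x) φ x =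
      pullback ν Y₁ Y₂ f φ x + pullback ν Y₁ Y₂ g φ x := by
    intro φ x
    by_cases hx : x ∈ thickening 3 A
    · have hxB : x ∉ thickening 3 B := fun hxB => by
        have := hfar x (thickening_mono (by norm_num) _ hx) x
          (thickening_mono (by norm_num) _ hxB)
        rw [dist_self] at this
        linarith
      have h0 := eq_zero_of_notMem_thickening hg hxB
      rw [pullback_eq_zero h0, add_zero]
      exact pullback_congr (fun y hy => by rw [h0 y hy, add_zero]) φ
    · have h0 := eq_zero_of_notMem_thickening hf hx
      rw [pullback_eq_zero h0, zero_add]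
      exact pullback_congr (fun y hy => by rw [h0 y hy, zero_add]) φ
  have hfin : ∀ {D : Set (Space d)} {f : Space d → ℕ}, Bornology.IsBounded D → IsTest D f →
      ∀ φ : PointMeasure d, ∫⁻ y, pullback ν Y₁ Y₂ f φ y ∂φ.1 ≠ ∞ := by
    intro D f hD hf φ
    obtain ⟨N, hN⟩ := hf.bounded
    rw [← lintegral_pullback_restrictTo hY₁' hY₂' hf, restrictTo_coe]
    refine ((lintegral_mono fun x => (pullback_le hN _ x).1).trans_lt ?_).ne
    rw [setLIntegral_const]
    exact ENNReal.mul_lt_top (by simp) (measure_lt_top_of_isBounded φ hD.thickening)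
  have e1 := h.laplace_eq hY₁ hY₂ hV hVi hν hΦ (hA'.union hB') (hf.add hg)
  have e2 := h.laplace_eq hY₁ hY₂ hV hVi hν hΦ hA' hf
  have e3 := h.laplace_eq hY₁ hY₂ hV hVi hν hΦ hB' hg
  push_cast at e1
  rw [e1, e2, e3]
  have hprod := lintegral_mul_eq_lintegral_mul_lintegral_of_indepFun''
    ((hmeas hf).comp ((measurable_restrictTo _ _).comp hΦ)).aemeasurable
    ((hmeas hg).comp ((measurable_restrictTo _ _).comp hΦ)).aemeasurable
    (key.comp (hmeas hf) (hmeas hg))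
  simp only [Function.comp_def, lintegral_pullback_restrictTo hY₁' hY₂' hf,
    lintegral_pullback_restrictTo hY₁' hY₂' hg] at hprod
  rw [← hprod]
  refine lintegral_congr fun ω => ?_
  simp_rw [hadd]
  rw [lintegral_add_left (measurable_pullback_right hY₁ hY₂ hf _),
    expNeg_add (hfin hA' hf _) (hfin hB' hg _)]

end

/-! ### First and second moments of the counts after an update. -/

section

variable {d : ℕ}

/-- For independent indicators the variance of the sum is ∑ (p - p²); negative terms are moved
across the equation to avoid truncated subtraction. -/
theorem lintegral_sq_tsum_of_iIndepFun {Ω ι : Type*} [MeasurableSpace Ω] {P : Measure Ω}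
    [Countable ι] {a : ι → Ω → ℝ≥0∞} (ha : ∀ i, Measurable (a i)) (hind : iIndepFun a P)
    (hsq : ∀ i ω, a i ω * a i ω = a i ω) :
    ∫⁻ ω, (∑' i, a i ω) ^ 2 ∂P + ∑' i, (∫⁻ ω, a i ω ∂P) ^ 2 =
      (∑' i, ∫⁻ ω, a i ω ∂P) ^ 2 + ∑' i, ∫⁻ ω, a i ω ∂P := by
  classical
  simp_rw [sq, ← ENNReal.tsum_mul_left, ← ENNReal.tsum_mul_right]
  have hm : ∀ i j, Measurable fun ω => a j ω * a i ω := fun i j => (ha j).mul (ha i)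
  rw [lintegral_tsum fun i => (Measurable.tsum (hm i)).aemeasurable]
  have hs : ∀ i, ∫⁻ ω, ∑' j, a j ω * a i ω ∂P = ∑' j, ∫⁻ ω, a j ω * a i ω ∂P := fun i =>
    lintegral_tsum fun j => (hm i j).aemeasurable
  simp_rw [hs]
  rw [← ENNReal.tsum_add, ← ENNReal.tsum_add]
  refine tsum_congr fun i => ?_
  have h : ∀ j, ∫⁻ ω, a j ω * a i ω ∂P +
        (if j = i then (∫⁻ ω, a i ω ∂P) * ∫⁻ ω, a i ω ∂P else 0) =
      (∫⁻ ω, a j ω ∂P) * (∫⁻ ω, a i ω ∂P) + if j = i then ∫⁻ ω, a i ω ∂P else 0 := by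
    intro j
    by_cases hji : j = i
    · subst hji
      simp [hsq, add_comm]
    · simp only [hji, if_false, add_zero]
      exact lintegral_mul_eq_lintegral_mul_lintegral_of_indepFun (ha j) (ha i)
        (hind.indepFun hji)
  have h' := tsum_congr (L := SummationFilter.unconditional ι) h
  rwa [ENNReal.tsum_add, ENNReal.tsum_add, tsum_ite_eq, tsum_ite_eq] at h'

variable {Ω : Type*} [MeasurableSpace Ω] {P : Measure Ω} [IsProbabilityMeasure P]
  {Y₁ : PointMeasure d → ({0, 1} : Set ℝ)} {Y₂ : PointMeasure d → UnitBall d}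
  {V : ℕ → Ω → UnitBall d} {Φ Φ' : Ω → PointMeasure d} {ν : Measure (UnitBall d)}

/-- The probability that the point `x` of the configuration `φ` is moved to a point of `B`. -/
abbrev hitProb (ν : Measure (UnitBall d)) (Y₁ : PointMeasure d → ({0, 1} : Set ℝ))
    (Y₂ : PointMeasure d → UnitBall d) (B : Set (Space d)) (φ : PointMeasure d) (x : Space d) :
    ℝ≥0∞ :=
  meanDisplace ν Y₁ Y₂ (B.indicator 1) φ x

theorem measurable_hitProb_right [SFinite ν] (hY₁ : Measurable Y₁) (hY₂ : Measurable Y₂)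
    {B : Set (Space d)} (hB : MeasurableSet B) (φ : PointMeasure d) :
    Measurable fun x => hitProb ν Y₁ Y₂ B φ x := by
  have h := measurable_meanDisplace (ν := ν) hY₁ hY₂ (measurable_one.indicator hB)
  exact h.of_uncurry_left

theorem hitProb_le_one [IsProbabilityMeasure ν] (B : Set (Space d)) (φ : PointMeasure d)
    (x : Space d) : hitProb ν Y₁ Y₂ B φ x ≤ 1 := by
  refine (lintegral_mono fun u => Set.indicator_le_self' (fun _ _ => zero_le) _).trans ?_
  simp

/-- The conditional mean of the number of points in `B` after one update. -/
def condMean (ν : Measure (UnitBall d)) (Y₁ : PointMeasure d → ({0, 1} : Set ℝ))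
    (Y₂ : PointMeasure d → UnitBall d) (B : Set (Space d)) (φ : PointMeasure d) : ℝ≥0∞ :=
  ∫⁻ x, hitProb ν Y₁ Y₂ B φ x ∂φ.1

theorem measurable_condMean [SFinite ν] (hY₁ : Measurable Y₁) (hY₂ : Measurable Y₂)
    {B : Set (Space d)} (hB : MeasurableSet B) : Measurable (condMean ν Y₁ Y₂ B) :=
  measurable_lintegral_pointMeasure
    (measurable_meanDisplace hY₁ hY₂ (measurable_one.indicator hB))

theorem IsUpdate.lintegral_count (h : IsUpdate P Y₁ Y₂ V Φ Φ') (hY₁ : Measurable Y₁)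
    (hY₂ : Measurable Y₂) (hV : ∀ i, Measurable (V i)) (hν : ∀ i, P.map (V i) = ν)
    (hΦ : Measurable Φ) {B : Set (Space d)} (hB : MeasurableSet B) :
    ∫⁻ ω, (Φ' ω).1 B ∂P = ∫⁻ ω, condMean ν Y₁ Y₂ B (Φ ω) ∂P := by
  have : IsProbabilityMeasure ν := hν 0 ▸ Measure.isProbabilityMeasure_map (hV 0).aemeasurable
  have hm := measurable_one (α := ℝ≥0∞).indicator hB
  obtain ⟨X, hX, hH⟩ := h.exists_listing hY₁ hY₂ hV hΦ
  have := hH _ _ measurable_id hm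
  simp only [id, lintegral_indicator_one hB] at this
  rw [this]
  refine lintegral_congr_ae (hX.mono fun ω hω => ?_)
  simp only
  rw [condMean, lintegral_of_eq_sum_dirac hω (measurable_hitProb_right hY₁ hY₂ hB _)]
  refine (lintegral_tsum fun i =>
    (hm.comp ((measurable_displace_right hY₁ hY₂ _ _).comp (hV _))).aemeasurable).trans ?_
  exact tsum_congr fun i => lintegral_displace hY₁ hY₂ (hV _) (hν _) hm _ _

/-- Given the old configuration and its listing, the hits of `B` are independent indicators, so the
preceding identity applies before averaging over the configuration. -/
theorem IsUpdate.lintegral_count_sq (h : IsUpdate P Y₁ Y₂ V Φ Φ') (hY₁ : Measurable Y₁)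
    (hY₂ : Measurable Y₂) (hV : ∀ i, Measurable (V i)) (hVi : iIndepFun V P)
    (hν : ∀ i, P.map (V i) = ν) (hΦ : Measurable Φ) {B : Set (Space d)} (hB : MeasurableSet B) :
    ∫⁻ ω, (Φ' ω).1 B ^ 2 ∂P + ∫⁻ ω, ∫⁻ x, hitProb ν Y₁ Y₂ B (Φ ω) x ^ 2 ∂(Φ ω).1 ∂P =
      ∫⁻ ω, condMean ν Y₁ Y₂ B (Φ ω) ^ 2 ∂P + ∫⁻ ω, condMean ν Y₁ Y₂ B (Φ ω) ∂P := by
  have : IsProbabilityMeasure ν := hν 0 ▸ Measure.isProbabilityMeasure_map (hV 0).aemeasurable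
  have hm := measurable_one (α := ℝ≥0∞).indicator hB
  obtain ⟨X, hX, hH⟩ := h.exists_listing hY₁ hY₂ hV hΦ
  have := hH _ _ (measurable_id.pow_const 2) hm
  simp only [id, lintegral_indicator_one hB] at this
  have hp : Measurable fun φ : PointMeasure d => ∫⁻ x, hitProb ν Y₁ Y₂ B φ x ^ 2 ∂φ.1 :=
    measurable_lintegral_pointMeasure ((measurable_meanDisplace hY₁ hY₂ hm).pow_const 2)
  have hp' : Measurable fun ω => ∫⁻ x, hitProb ν Y₁ Y₂ B (Φ ω) x ^ 2 ∂(Φ ω).1 := hp.comp hΦ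
  have hc : Measurable fun ω => condMean ν Y₁ Y₂ B (Φ ω) :=
    (measurable_condMean (ν := ν) hY₁ hY₂ hB).comp hΦ
  rw [this, ← lintegral_add_right _ hp', ← lintegral_add_right _ hc]
  refine lintegral_congr_ae (hX.mono fun ω hω => ?_)
  have hpm := measurable_hitProb_right (ν := ν) hY₁ hY₂ hB (Φ ω)
  beta_reduce
  rw [condMean, lintegral_of_eq_sum_dirac hω hpm, lintegral_of_eq_sum_dirac hω (hpm.pow_const 2)]
  have hm' : ∀ i : Index (Φ ω), Measurable fun u =>
      B.indicator (1 : Space d → ℝ≥0∞) (displace Y₁ Y₂ (Φ ω) (X ω i) u) := fun i =>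
    hm.comp (measurable_displace_right hY₁ hY₂ _ _)
  have hi : ∀ i : Index (Φ ω), ∫⁻ ω', B.indicator (1 : Space d → ℝ≥0∞)
      (displace Y₁ Y₂ (Φ ω) (X ω i) (V i ω')) ∂P = hitProb ν Y₁ Y₂ B (Φ ω) (X ω i) := fun i =>
    lintegral_displace hY₁ hY₂ (hV _) (hν _) hm _ _
  simp_rw [← hi]
  refine lintegral_sq_tsum_of_iIndepFun (fun i => (hm' i).comp (hV i))
    ((hVi.precomp (g := fun i : Index (Φ ω) => i.1) Subtype.val_injective).comp _ hm')
    fun i ω' => ?_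
  by_cases h : displace Y₁ Y₂ (Φ ω) (X ω i) (V i ω') ∈ B <;> simp [h]

omit [IsProbabilityMeasure P] in
/-- No point moves by more than `2`. -/
theorem IsUpdate.count_le (h : IsUpdate P Y₁ Y₂ V Φ Φ') {A B : Set (Space d)}
    (hA : MeasurableSet A) (hB : MeasurableSet B) (hAB : ∀ x, ∀ y ∈ A, dist y x ≤ 2 → x ∈ B) :
    ∀ᵐ ω ∂P, (Φ' ω).1 A ≤ (Φ ω).1 B := by
  obtain ⟨X, -, -, hlist, hnew⟩ := h
  filter_upwards [hlist, hnew] with ω h1 h2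
  rw [← lintegral_indicator_one hA, ← lintegral_indicator_one hB,
    lintegral_of_eq_sum_dirac h1 (measurable_one.indicator hB),
    lintegral_of_eq_sum_dirac h2 (measurable_one.indicator hA)]
  refine ENNReal.tsum_le_tsum fun i => ?_
  by_cases hi : displace Y₁ Y₂ (Φ ω) (X i ω) (V i ω) ∈ A
  · rw [Set.indicator_of_mem hi, Set.indicator_of_mem (hAB _ _ hi (dist_displace_le _ _ _ _ _))]
    rfl
  · simp [hi]

end

/-! ### Variance inequalities and the partition into unit cubes. -/

section

section Variance

variable {Ω : Type*} [MeasurableSpace Ω] {P : Measure Ω} [IsProbabilityMeasure P]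

theorem covariance_le_half_add {X Y : Ω → ℝ} (hX : MemLp X 2 P) (hY : MemLp Y 2 P) :
    covariance X Y P ≤ (variance X P + variance Y P) / 2 := by
  have h := variance_nonneg (X - Y) P
  rw [variance_sub hX hY] at h
  linarith

/-- The variance of tX + Y is a nonnegative quadratic in t, so its discriminant is at most 0. -/
theorem abs_covariance_le_sqrt {X Y : Ω → ℝ} (hX : MemLp X 2 P) (hY : MemLp Y 2 P) :
    |covariance X Y P| ≤ √(variance X P * variance Y P) := by
  have h : discrim (variance X P) (2 * covariance X Y P) (variance Y P) ≤ 0 := by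
    refine discrim_le_zero fun t => ?_
    have h := variance_nonneg (t • X + Y) P
    rw [variance_add (hX.const_smul t) hY, variance_smul, covariance_smul_left] at h
    linarith
  rw [discrim] at h
  exact Real.abs_le_sqrt (by linarith)

/-- Each row of the covariance matrix has at most `N` nonzero entries, each at most `M` by
`covariance_le_half_add`. -/
theorem variance_sum_le {ι : Type*} (s : Finset ι) {G : ι → Ω → ℝ}
    (hG : ∀ i ∈ s, MemLp (G i) 2 P) {M N : ℝ} (hM : ∀ i ∈ s, variance (G i) P ≤ M)
    (near : ι → ι → Prop) [DecidableRel near]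
    (hfar : ∀ i ∈ s, ∀ j ∈ s, ¬ near i j → covariance (G i) (G j) P = 0)
    (hN : ∀ i ∈ s, ((s.filter (near i)).card : ℝ) ≤ N) :
    variance (fun ω => ∑ i ∈ s, G i ω) P ≤ s.card * (N * M) := by
  rw [variance_fun_sum' hG, ← nsmul_eq_mul]
  refine Finset.sum_le_card_nsmul _ _ _ fun i hi => ?_
  have hM0 : 0 ≤ M := (variance_nonneg _ _).trans (hM i hi)
  calc ∑ j ∈ s, covariance (G i) (G j) P
      = ∑ j ∈ s with near i j, covariance (G i) (G j) P :=
        (Finset.sum_filter_of_ne fun j hj h => by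
          by_contra hn
          exact h (hfar i hi j hj hn)).symm
    _ ≤ (s.filter (near i)).card • M := by
        refine Finset.sum_le_card_nsmul _ _ _ fun j hj => ?_
        have hj' := (Finset.mem_filter.1 hj).1
        have := covariance_le_half_add (hG i hi) (hG j hj')
        linarith [hM i hi, hM j hj']
    _ ≤ N * M := by
        rw [nsmul_eq_mul]
        exact mul_le_mul_of_nonneg_right (hN i hi) hM0

omit [IsProbabilityMeasure P] in
theorem memLp_toReal_two {N : Ω → ℝ≥0∞} (hN : Measurable N) (h : ∫⁻ ω, N ω ^ 2 ∂P ≠ ∞) :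
    MemLp (fun ω => (N ω).toReal) 2 P := by
  rw [memLp_two_iff_integrable_sq hN.ennreal_toReal.aestronglyMeasurable]
  simp_rw [← ENNReal.toReal_pow]
  exact integrable_toReal_of_lintegral_ne_top (hN.pow_const 2).aemeasurable h

theorem variance_toReal {N : Ω → ℝ≥0∞} (hN : Measurable N) (h : ∫⁻ ω, N ω ^ 2 ∂P ≠ ∞) :
    variance (fun ω => (N ω).toReal) P =
      (∫⁻ ω, N ω ^ 2 ∂P).toReal - (∫⁻ ω, N ω ∂P).toReal ^ 2 := by
  have hfin : ∀ᵐ ω ∂P, N ω ^ 2 < ∞ := ae_lt_top (hN.pow_const 2) h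
  rw [variance_eq_sub (memLp_toReal_two hN h)]
  simp only [Pi.pow_apply]
  simp_rw [← ENNReal.toReal_pow]
  rw [integral_toReal (hN.pow_const 2).aemeasurable hfin, integral_toReal hN.aemeasurable, ENNReal.toReal_pow]
  exact hfin.mono fun ω hω => by simpa using hω

theorem lintegral_le_one_add_sq (N : Ω → ℝ≥0∞) :
    ∫⁻ ω, N ω ∂P ≤ 1 + ∫⁻ ω, N ω ^ 2 ∂P := by
  calc ∫⁻ ω, N ω ∂P ≤ ∫⁻ ω, 1 + N ω ^ 2 ∂P := by
        refine lintegral_mono fun ω => ?_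
        rcases le_total (N ω) 1 with h | h
        · exact h.trans le_self_add
        · exact (le_self_pow₀ h two_ne_zero).trans le_add_self
    _ = 1 + ∫⁻ ω, N ω ^ 2 ∂P := by
        rw [lintegral_add_left measurable_const]
        simp

end Variance

variable {d : ℕ}

/-- The integer parts of the coordinates of a point. -/
def cell (x : Space d) : Fin d → ℤ := fun i => ⌊x i⌋

/-- The half-open unit cube with lower corner `z`. -/
def cube (z : Fin d → ℤ) : Set (Space d) := cell ⁻¹' {z}

/-- The lower corner of the cube `cube z`. -/
def corner (z : Fin d → ℤ) : Space d := WithLp.toLp 2 fun i => (z i : ℝ)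

theorem measurable_cell : Measurable (cell (d := d)) :=
  measurable_pi_lambda _ fun i => Int.measurable_floor.comp (by fun_prop)

theorem measurableSet_cube (z : Fin d → ℤ) : MeasurableSet (cube z) :=
  measurable_cell (measurableSet_singleton z)

theorem volume_cube (z : Fin d → ℤ) : volume (cube z) = 1 := by
  have h : cube z = (WithLp.ofLp : Space d → Fin d → ℝ) ⁻¹'
      (Set.univ.pi fun i => Set.Ico (z i : ℝ) (z i + 1)) := by
    ext x
    simp only [cube, cell, Set.mem_preimage, Set.mem_singleton_iff, funext_iff, Int.floor_eq_iff,
      Set.mem_univ_pi, Set.mem_Ico]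
  rw [h, (PiLp.volume_preserving_ofLp (Fin d)).measure_preimage
    (MeasurableSet.univ_pi fun i => measurableSet_Ico).nullMeasurableSet, Real.volume_pi_Ico]
  simp

theorem pairwise_disjoint_cube : Pairwise (Function.onFun Disjoint (cube (d := d))) :=
  fun _ _ h => Disjoint.preimage _ (Set.disjoint_singleton.2 h)

theorem dist_corner_le {z : Fin d → ℤ} {x : Space d} (hx : x ∈ cube z) :
    dist x (corner z) ≤ d := by
  have h : ∀ i, |x i - z i| ≤ 1 := fun i => by
    have h1 : ⌊x i⌋ = z i := congrFun hx i
    rw [← h1, Int.self_sub_floor, abs_of_nonneg (Int.fract_nonneg _)]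
    exact (Int.fract_lt_one _).le
  rw [EuclideanSpace.dist_eq]
  refine Real.sqrt_le_iff.2 ⟨by positivity, ?_⟩
  calc ∑ i, dist (x i) (corner z i) ^ 2 ≤ ∑ _i : Fin d, (1 : ℝ) := by
        refine Finset.sum_le_sum fun i _ => ?_
        rw [Real.dist_eq]
        exact pow_le_one₀ (abs_nonneg _) (h i)
    _ ≤ (d : ℝ) ^ 2 := by
        simp only [Finset.sum_const, Finset.card_univ, Fintype.card_fin, nsmul_eq_mul, mul_one]
        exact_mod_cast Nat.le_self_pow two_ne_zero d

theorem dist_le_of_mem_cube {z : Fin d → ℤ} {x y : Space d} (hx : x ∈ cube z) (hy : y ∈ cube z) :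
    dist x y ≤ 2 * d := by
  linarith [dist_triangle_right x y (corner z), dist_corner_le hx, dist_corner_le hy]

theorem finite_cells {T : Set (Space d)} (hT : Bornology.IsBounded T) :
    {z | (cube z ∩ T).Nonempty}.Finite := by
  obtain ⟨ρ, hρ⟩ := hT.exists_norm_le
  refine (Set.finite_Icc (fun _ : Fin d => ⌊-ρ⌋) fun _ => ⌊ρ⌋).subset ?_
  rintro z ⟨x, rfl, hx⟩
  have h : ∀ i, |x i| ≤ ρ := fun i => (PiLp.norm_apply_le x i).trans (hρ x hx)
  exact ⟨fun i => Int.floor_mono (abs_le.1 (h i)).1, fun i => Int.floor_mono (abs_le.1 (h i)).2⟩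

/-- The cubes are disjoint of volume 1. This bounds both the number of cubes at the boundary and the
number of cubes near a given one. -/
theorem card_le_volume (S : Finset (Fin d → ℤ)) {T : Set (Space d)}
    (hS : ∀ z ∈ S, cube z ⊆ T) : (S.card : ℝ≥0∞) ≤ volume T := by
  calc (S.card : ℝ≥0∞) = ∑ z ∈ S, volume (cube z) := by simp [volume_cube]
    _ = volume (⋃ z ∈ S, cube z) := (measure_biUnion_finset
        (fun _ _ _ _ h => pairwise_disjoint_cube h) fun z _ => measurableSet_cube z).symm
    _ ≤ volume T := measure_mono (Set.iUnion₂_subset hS)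

theorem card_le_volume_toReal (S : Finset (Fin d → ℤ)) {T : Set (Space d)}
    (hT : volume T ≠ ∞) (hS : ∀ z ∈ S, cube z ⊆ T) : (S.card : ℝ) ≤ (volume T).toReal := by
  simpa using ENNReal.toReal_mono hT (card_le_volume S hS)

end

/-! ### Uniform moments, and the conditional mean as a sum over cubes. -/

section

variable {d : ℕ}

variable {Ω : Type*} [MeasurableSpace Ω] {P : Measure Ω} [IsProbabilityMeasure P]
  {Y₁ : PointMeasure d → ({0, 1} : Set ℝ)} {Y₂ : PointMeasure d → UnitBall d}
  {V : ℕ → Ω → UnitBall d} {Φ Φ' : Ω → PointMeasure d} {ν : Measure (UnitBall d)}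

/-- The second moments of the numbers of points in balls are bounded, uniformly in the center. -/
def HasUniformMoments (P : Measure Ω) (Φ : Ω → PointMeasure d) : Prop :=
  ∀ ρ : ℝ, ∃ M : ℝ≥0, ∀ x, ∫⁻ ω, (Φ ω).1 (closedBall x ρ) ^ 2 ∂P ≤ M

omit [IsProbabilityMeasure P] in
theorem HasUniformMoments.ne_top (h : HasUniformMoments P Φ) {B : Set (Space d)}
    (hB : Bornology.IsBounded B) : ∫⁻ ω, (Φ ω).1 B ^ 2 ∂P ≠ ∞ := by
  obtain ⟨ρ, hρ⟩ := hB.subset_closedBall 0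
  obtain ⟨M, hM⟩ := h ρ
  refine (lt_of_le_of_lt ?_ (ENNReal.coe_lt_top (r := M))).ne
  refine le_trans (lintegral_mono fun ω => ?_) (hM 0)
  gcongr

omit [IsProbabilityMeasure P] in
theorem HasUniformMoments.locallySquareIntegrable (h : HasUniformMoments P Φ)
    (hΦ : Measurable Φ) : LocallySquareIntegrable P Φ := fun _ hB hB' =>
  memLp_toReal_two ((measurable_eval hB).comp hΦ) (h.ne_top hB')

-- Bounds uniform in the center take the place of stationarity of the later processes: points found
-- in a ball after the update come from the ball with radius larger by 2.
omit [IsProbabilityMeasure P] in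
theorem HasUniformMoments.update (hM : HasUniformMoments P Φ)
    (h : IsUpdate P Y₁ Y₂ V Φ Φ') : HasUniformMoments P Φ' := by
  intro ρ
  obtain ⟨M, hM⟩ := hM (ρ + 2)
  refine ⟨M, fun x => le_trans (lintegral_mono_ae ?_) (hM x)⟩
  have := h.count_le (A := closedBall x ρ) (B := closedBall x (ρ + 2)) measurableSet_closedBall
    measurableSet_closedBall fun y z hz hzy => by
      rw [mem_closedBall] at hz ⊢
      linarith [dist_triangle_left y x z]
  filter_upwards [this] with ω hω
  gcongr

/-- A point outside this shell cannot cross the sphere with a move of length at most 2. -/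
theorem hitProb_eq_indicator [IsProbabilityMeasure ν] {r : ℝ} {x : Space d}
    (hx : x ∉ closedBall (0 : Space d) (r + 2) \ closedBall 0 (r - 2)) (φ : PointMeasure d) :
    hitProb ν Y₁ Y₂ (closedBall 0 r) φ x = (closedBall (0 : Space d) r).indicator 1 x := by
  have h0 : ∀ {c : ℝ≥0∞}, (∀ y, dist y x ≤ 2 →
      (closedBall (0 : Space d) r).indicator (1 : Space d → ℝ≥0∞) y = c) →
      hitProb ν Y₁ Y₂ (closedBall 0 r) φ x = (closedBall (0 : Space d) r).indicator 1 x := by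
    intro c h
    rw [hitProb, meanDisplace_congr h φ, meanDisplace_const, h x (by simp)]
  by_cases h : x ∈ closedBall (0 : Space d) (r - 2)
  · refine h0 (c := 1) fun y hy => ?_
    rw [Set.indicator_of_mem]
    · rfl
    · rw [mem_closedBall] at h ⊢
      linarith [dist_triangle y x 0]
  · have h' : x ∉ closedBall (0 : Space d) (r + 2) := fun h' => hx ⟨h', h⟩
    refine h0 (c := 0) fun y hy => Set.indicator_of_notMem (fun hy' => h' ?_) _
    rw [mem_closedBall] at hy' ⊢
    linarith [dist_triangle_left x 0 y]

/-- The conditional mean change of the number of points in `B` that is due to the points in the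
cube `cube z`. -/
def meanChange (ν : Measure (UnitBall d)) (Y₁ : PointMeasure d → ({0, 1} : Set ℝ))
    (Y₂ : PointMeasure d → UnitBall d) (B : Set (Space d)) (z : Fin d → ℤ) (φ : PointMeasure d) :
    ℝ :=
  (∫⁻ x in cube z, hitProb ν Y₁ Y₂ B φ x ∂φ.1).toReal -
    (∫⁻ x in cube z, B.indicator 1 x ∂φ.1).toReal

theorem isBounded_cube (z : Fin d → ℤ) : Bornology.IsBounded (cube z) :=
  isBounded_closedBall.subset fun _ hx => mem_closedBall.2 (dist_corner_le hx)

theorem setLIntegral_le_measure_cube {f : Space d → ℝ≥0∞} (hf : ∀ x, f x ≤ 1)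
    (φ : PointMeasure d) (z : Fin d → ℤ) : ∫⁻ x in cube z, f x ∂φ.1 ≤ φ.1 (cube z) := by
  refine (lintegral_mono hf).trans ?_
  simp

theorem abs_meanChange_le [IsProbabilityMeasure ν] (B : Set (Space d)) (z : Fin d → ℤ)
    (φ : PointMeasure d) : |meanChange ν Y₁ Y₂ B z φ| ≤ (φ.1 (cube z)).toReal := by
  have hfin := (measure_lt_top_of_isBounded φ (isBounded_cube z)).ne
  have h1 := ENNReal.toReal_mono hfin (setLIntegral_le_measure_cube
    (hitProb_le_one (ν := ν) (Y₁ := Y₁) (Y₂ := Y₂) B φ) φ z)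
  have h2 := ENNReal.toReal_mono hfin (setLIntegral_le_measure_cube
    (f := B.indicator 1) (fun x => Set.indicator_le_self' (fun _ _ => zero_le) x) φ z)
  rw [meanChange, abs_sub_le_iff]
  constructor <;> linarith [ENNReal.toReal_nonneg (a := ∫⁻ x in cube z, B.indicator 1 x ∂φ.1),
    ENNReal.toReal_nonneg (a := ∫⁻ x in cube z, hitProb ν Y₁ Y₂ B φ x ∂φ.1)]

theorem measurable_meanChange [SFinite ν] (hY₁ : Measurable Y₁) (hY₂ : Measurable Y₂)
    {B : Set (Space d)} (hB : MeasurableSet B) (z : Fin d → ℤ) :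
    Measurable (meanChange ν Y₁ Y₂ B z) := by
  have h : ∀ {f : PointMeasure d → Space d → ℝ≥0∞}, Measurable (fun q : _ × _ => f q.1 q.2) →
      Measurable fun φ : PointMeasure d => ∫⁻ x in cube z, f φ x ∂φ.1 := fun {f} hf => by
    simp_rw [← lintegral_indicator (measurableSet_cube z)]
    have h1 := hf.indicator (measurable_snd (measurableSet_cube z) :
      MeasurableSet {q : PointMeasure d × Space d | q.2 ∈ cube z})
    exact measurable_lintegral_pointMeasure h1
  have hm := measurable_one (α := ℝ≥0∞).indicator hB
  exact (h (measurable_meanDisplace hY₁ hY₂ hm)).ennreal_toReal.sub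
    (h (f := fun _ => B.indicator 1) (hm.comp measurable_snd)).ennreal_toReal

/-- The cube lies within `d` of its corner, and locality looks 1 further. -/
theorem meanChange_restrictTo (hY₁ : IsLocal Y₁) (hY₂ : IsLocal Y₂) (B : Set (Space d))
    (z : Fin d → ℤ) (φ : PointMeasure d) :
    meanChange ν Y₁ Y₂ B z
      (restrictTo (closedBall (corner z) (d + 1)) measurableSet_closedBall φ) =
      meanChange ν Y₁ Y₂ B z φ := by
  have hsub : cube z ⊆ closedBall (corner z) (d + 1) := fun x hx =>
    mem_closedBall.2 ((dist_corner_le hx).trans (by linarith))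
  rw [meanChange, meanChange, restrictTo_coe, Measure.restrict_restrict (measurableSet_cube z),
    Set.inter_eq_left.2 hsub]
  congr 2
  refine setLIntegral_congr_fun (measurableSet_cube z) fun x hx => ?_
  refine meanDisplace_restrictTo hY₁ hY₂ _ _ φ fun y hy => ?_
  rw [mem_closedBall] at hy ⊢
  linarith [dist_triangle y x (corner z), dist_corner_le hx]

omit [IsProbabilityMeasure P] in
theorem memLp_meanChange [IsProbabilityMeasure ν] (hM : HasUniformMoments P Φ)
    (hΦ : Measurable Φ) (hY₁ : Measurable Y₁) (hY₂ : Measurable Y₂)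
    {B : Set (Space d)} (hB : MeasurableSet B) (z : Fin d → ℤ) :
    MemLp (fun ω => meanChange ν Y₁ Y₂ B z (Φ ω)) 2 P :=
  (memLp_toReal_two ((measurable_eval (measurableSet_cube z)).comp hΦ)
    (hM.ne_top (isBounded_cube z))).mono
    ((measurable_meanChange hY₁ hY₂ hB z).comp hΦ).aestronglyMeasurable
    (.of_forall fun ω => by
      simpa [abs_of_nonneg ENNReal.toReal_nonneg] using abs_meanChange_le B z (Φ ω))

theorem variance_meanChange_le [IsProbabilityMeasure ν] (hM : HasUniformMoments P Φ)
    (hΦ : Measurable Φ) (hY₁ : Measurable Y₁) (hY₂ : Measurable Y₂)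
    {B : Set (Space d)} (hB : MeasurableSet B) (z : Fin d → ℤ) :
    variance (fun ω => meanChange ν Y₁ Y₂ B z (Φ ω)) P ≤
      (∫⁻ ω, (Φ ω).1 (cube z) ^ 2 ∂P).toReal := by
  have hN : Measurable fun ω => (Φ ω).1 (cube z) := (measurable_eval (measurableSet_cube z)).comp hΦ
  have hfin := hM.ne_top (isBounded_cube z)
  refine (variance_le_expectation_sq
    ((measurable_meanChange hY₁ hY₂ hB z).comp hΦ).aestronglyMeasurable).trans ?_
  rw [← integral_toReal (hN.pow_const 2).aemeasurable (ae_lt_top (hN.pow_const 2) hfin)]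
  refine integral_mono (memLp_meanChange hM hΦ hY₁ hY₂ hB z).integrable_sq
    (integrable_toReal_of_lintegral_ne_top (hN.pow_const 2).aemeasurable hfin) fun ω => ?_
  simp only [Pi.pow_apply, ENNReal.toReal_pow]
  exact sq_le_sq.2 ((abs_meanChange_le B z (Φ ω)).trans (le_abs_self _))

-- The two terms depend on the process in balls of radius `d + 1` around the corners, which are more
-- than `R` apart.
omit [IsProbabilityMeasure P] in
theorem covariance_meanChange_eq_zero [IsProbabilityMeasure ν] (hM : HasUniformMoments P Φ)
    {R : ℝ} (hR : HasFiniteRange P Φ R) (hΦ : Measurable Φ) (hY₁ : Measurable Y₁)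
    (hY₂ : Measurable Y₂) (hY₁' : IsLocal Y₁) (hY₂' : IsLocal Y₂)
    {B : Set (Space d)} (hB : MeasurableSet B) {z w : Fin d → ℤ}
    (hzw : R + 2 * (d + 1) < dist (corner z) (corner w)) :
    covariance (fun ω => meanChange ν Y₁ Y₂ B z (Φ ω)) (fun ω => meanChange ν Y₁ Y₂ B w (Φ ω)) P =
      0 := by
  refine IndepFun.covariance_eq_zero ?_ (memLp_meanChange hM hΦ hY₁ hY₂ hB z)
    (memLp_meanChange hM hΦ hY₁ hY₂ hB w)
  have h := hR (closedBall (corner z) (d + 1)) (closedBall (corner w) (d + 1))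
    measurableSet_closedBall measurableSet_closedBall isBounded_closedBall isBounded_closedBall
    fun a ha b hb => by
      rw [mem_closedBall] at ha hb
      have := dist_triangle4 (corner z) a b (corner w)
      rw [dist_comm (corner z) a] at this
      linarith
  have := h.comp (measurable_meanChange (ν := ν) hY₁ hY₂ hB z)
    (measurable_meanChange (ν := ν) hY₁ hY₂ hB w)
  simpa only [Function.comp_def, meanChange_restrictTo hY₁' hY₂'] using this

/-- Off the cubes of `Z` the integrands of the conditional mean and of the old count agree. Their
common integral there is at most `φ.1 B`, hence finite, and cancels. -/
theorem condMean_toReal_eq [IsProbabilityMeasure ν] {B : Set (Space d)} (hB : MeasurableSet B)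
    (hB' : Bornology.IsBounded B) {Z : Finset (Fin d → ℤ)} {φ : PointMeasure d}
    (hZ : ∀ x, cell x ∉ Z → hitProb ν Y₁ Y₂ B φ x = B.indicator 1 x) :
    condMean ν Y₁ Y₂ B φ ≠ ∞ ∧ (condMean ν Y₁ Y₂ B φ).toReal =
      (φ.1 B).toReal + ∑ z ∈ Z, meanChange ν Y₁ Y₂ B z φ := by
  have hT : MeasurableSet (⋃ z ∈ Z, cube z : Set (Space d)) :=
    Z.measurableSet_biUnion fun z _ => measurableSet_cube z
  have hsplit : ∀ f : Space d → ℝ≥0∞, ∫⁻ x, f x ∂φ.1 =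
      ∑ z ∈ Z, ∫⁻ x in cube z, f x ∂φ.1 + ∫⁻ x in (⋃ z ∈ Z, cube z)ᶜ, f x ∂φ.1 := fun f => by
    rw [← lintegral_biUnion_finset (fun _ _ _ _ h => pairwise_disjoint_cube h)
      fun z _ => measurableSet_cube z, lintegral_add_compl f hT]
  have hfin : ∀ f : Space d → ℝ≥0∞, (∀ x, f x ≤ 1) → ∀ z ∈ Z, ∫⁻ x in cube z, f x ∂φ.1 ≠ ∞ :=
    fun f hf z _ => ((setLIntegral_le_measure_cube hf φ z).trans_lt
      (measure_lt_top_of_isBounded φ (isBounded_cube z))).ne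
  have hout : ∫⁻ x in (⋃ z ∈ Z, cube z)ᶜ, hitProb ν Y₁ Y₂ B φ x ∂φ.1 =
      ∫⁻ x in (⋃ z ∈ Z, cube z)ᶜ, B.indicator 1 x ∂φ.1 := by
    refine setLIntegral_congr_fun hT.compl fun x hx => hZ x fun h => hx ?_
    exact Set.mem_biUnion (Finset.mem_coe.2 h) rfl
  have hB1 : ∫⁻ x, B.indicator 1 x ∂φ.1 = φ.1 B := lintegral_indicator_one hB
  have hBfin := (measure_lt_top_of_isBounded φ hB').ne
  have hfin1 := hfin _ (hitProb_le_one (ν := ν) (Y₁ := Y₁) (Y₂ := Y₂) B φ)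
  have hfin2 := hfin (B.indicator 1) fun x => Set.indicator_le_self' (fun _ _ => zero_le) x
  have hS := hsplit (fun x => hitProb ν Y₁ Y₂ B φ x)
  have hC := hsplit (B.indicator 1)
  rw [hB1] at hC
  have hfin3 : ∫⁻ x in (⋃ z ∈ Z, cube z)ᶜ, B.indicator 1 x ∂φ.1 ≠ ∞ :=
    fun h => hBfin (by rw [hC, h, add_top])
  rw [hout] at hS
  constructor
  · rw [condMean, hS]
    exact ENNReal.add_ne_top.2 ⟨ENNReal.sum_ne_top.2 hfin1, hfin3⟩
  · rw [condMean, hS, hC, ENNReal.toReal_add (ENNReal.sum_ne_top.2 hfin1) hfin3,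
      ENNReal.toReal_add (ENNReal.sum_ne_top.2 hfin2) hfin3, ENNReal.toReal_sum hfin1,
      ENNReal.toReal_sum hfin2]
    simp only [meanChange, Finset.sum_sub_distrib]
    ring

end

/-! ### An update changes the variance in a ball only to lower order. -/

section

variable {d : ℕ}

variable {Ω : Type*} [MeasurableSpace Ω] {P : Measure Ω} [IsProbabilityMeasure P]
  {Y₁ : PointMeasure d → ({0, 1} : Set ℝ)} {Y₂ : PointMeasure d → UnitBall d}
  {V : ℕ → Ω → UnitBall d} {Φ Φ' : Ω → PointMeasure d} {ν : Measure (UnitBall d)}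

/-- Off the cubes of `Z` the hit probability p is 0 or 1, so p = p². Thus the conditional variance ∑
(p - p²) is at most the number of points in these cubes. -/
theorem condMean_le [IsProbabilityMeasure ν] (hY₁ : Measurable Y₁) (hY₂ : Measurable Y₂)
    {B : Set (Space d)} (hB : MeasurableSet B) {Z : Finset (Fin d → ℤ)} {φ : PointMeasure d}
    (hZ : ∀ x, cell x ∉ Z → hitProb ν Y₁ Y₂ B φ x = B.indicator 1 x) :
    condMean ν Y₁ Y₂ B φ ≤
      ∫⁻ x, hitProb ν Y₁ Y₂ B φ x ^ 2 ∂φ.1 + ∑ z ∈ Z, φ.1 (cube z) := by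
  have hT : MeasurableSet (⋃ z ∈ Z, cube z : Set (Space d)) :=
    Z.measurableSet_biUnion fun z _ => measurableSet_cube z
  calc condMean ν Y₁ Y₂ B φ
      ≤ ∫⁻ x, hitProb ν Y₁ Y₂ B φ x ^ 2 + (⋃ z ∈ Z, cube z).indicator 1 x ∂φ.1 := by
        refine lintegral_mono fun x => ?_
        by_cases hx : cell x ∈ Z
        · have hx' : x ∈ ⋃ z ∈ Z, cube z := Set.mem_biUnion (Finset.mem_coe.2 hx) rfl
          rw [Set.indicator_of_mem hx']
          exact (hitProb_le_one B φ x).trans le_add_self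
        · rw [hZ x hx]
          by_cases h : x ∈ B <;> simp [h]
    _ = ∫⁻ x, hitProb ν Y₁ Y₂ B φ x ^ 2 ∂φ.1 + φ.1 (⋃ z ∈ Z, cube z) := by
        rw [lintegral_add_left ((measurable_hitProb_right hY₁ hY₂ hB φ).pow_const 2),
          lintegral_indicator_one hT]
    _ ≤ _ := by
        gcongr
        exact measure_biUnion_finset_le _ _

/-- The randomness of one displacement contributes to the variance of the number of points in `B`
only through the points close to the boundary of `B`. -/
theorem abs_variance_sub_variance_condMean_le (hM : HasUniformMoments P Φ)
    (h : IsUpdate P Y₁ Y₂ V Φ Φ') (hY₁ : Measurable Y₁) (hY₂ : Measurable Y₂)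
    (hV : ∀ i, Measurable (V i)) (hVi : iIndepFun V P)
    (hν : ∀ i, P.map (V i) = ν) (hΦ : Measurable Φ) (hΦ' : Measurable Φ')
    {B : Set (Space d)} (hB : MeasurableSet B) (hB' : Bornology.IsBounded B)
    {Z : Finset (Fin d → ℤ)}
    (hZ : ∀ φ x, cell x ∉ Z → hitProb ν Y₁ Y₂ B φ x = B.indicator 1 x) {M : ℝ≥0}
    (hMZ : ∀ z ∈ Z, ∫⁻ ω, (Φ ω).1 (cube z) ^ 2 ∂P ≤ M) :
    |variance (fun ω => ((Φ' ω).1 B).toReal) P -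
      variance (fun ω => (condMean ν Y₁ Y₂ B (Φ ω)).toReal) P| ≤ Z.card * (1 + M) := by
  have : IsProbabilityMeasure ν := hν 0 ▸ Measure.isProbabilityMeasure_map (hV 0).aemeasurable
  have hmS : Measurable fun ω => condMean ν Y₁ Y₂ B (Φ ω) :=
    (measurable_condMean (ν := ν) hY₁ hY₂ hB).comp hΦ
  have hN2 := (hM.update h).ne_top hB'
  have e1 := h.lintegral_count hY₁ hY₂ hV hν hΦ hB
  have e2 := h.lintegral_count_sq hY₁ hY₂ hV hVi hν hΦ hB
  set q := ∫⁻ ω, ∫⁻ x, hitProb ν Y₁ Y₂ B (Φ ω) x ^ 2 ∂(Φ ω).1 ∂P with hq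
  have hS1 : ∫⁻ ω, condMean ν Y₁ Y₂ B (Φ ω) ∂P ≠ ∞ := by
    rw [← e1]
    exact ((lintegral_le_one_add_sq _).trans_lt
      (ENNReal.add_lt_top.2 ⟨ENNReal.one_lt_top, hN2.lt_top⟩)).ne
  have hqS : q ≤ ∫⁻ ω, condMean ν Y₁ Y₂ B (Φ ω) ∂P :=
    lintegral_mono fun ω => lintegral_mono fun x => pow_le_of_le_one zero_le
      (hitProb_le_one B (Φ ω) x) two_ne_zero
  have hqfin : q ≠ ∞ := (hqS.trans_lt hS1.lt_top).ne
  -- The moment identity `e2` transfers finiteness from the new count to the conditional mean.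
  have hS2 : ∫⁻ ω, condMean ν Y₁ Y₂ B (Φ ω) ^ 2 ∂P ≠ ∞ := fun hS => by
    rw [hS, top_add] at e2
    exact ENNReal.add_ne_top.2 ⟨hN2, hqfin⟩ e2
  have hSq : ∫⁻ ω, condMean ν Y₁ Y₂ B (Φ ω) ∂P ≤ q + Z.card * (1 + M) := by
    have hc : ∀ z, Measurable fun ω => (Φ ω).1 (cube z) := fun z =>
      (measurable_eval (measurableSet_cube z)).comp hΦ
    have hm : Measurable fun ω => ∑ z ∈ Z, (Φ ω).1 (cube z) :=
      Finset.measurable_sum _ fun z _ => hc z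
    refine (lintegral_mono fun ω => condMean_le hY₁ hY₂ hB (hZ (Φ ω))).trans ?_
    rw [lintegral_add_right _ hm, lintegral_finsetSum _ fun z _ => hc z, ← nsmul_eq_mul]
    gcongr
    refine Finset.sum_le_card_nsmul _ _ _ fun z hz => ?_
    exact (lintegral_le_one_add_sq _).trans (add_le_add le_rfl (hMZ z hz))
  have hmN : Measurable fun ω => (Φ' ω).1 B := (measurable_eval hB).comp hΦ'
  rw [variance_toReal hmN hN2, variance_toReal hmS hS2, e1]
  have e3 := congrArg ENNReal.toReal e2
  rw [ENNReal.toReal_add hN2 hqfin, ENNReal.toReal_add hS2 hS1] at e3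
  have e4 := ENNReal.toReal_mono hS1 hqS
  have e5 := ENNReal.toReal_mono (by finiteness) hSq
  rw [ENNReal.toReal_add hqfin (by finiteness), ENNReal.toReal_mul,
    ENNReal.toReal_add (by finiteness) (by finiteness)] at e5
  simp only [ENNReal.toReal_natCast, ENNReal.toReal_one, ENNReal.coe_toReal] at e5
  -- The squared means agree by `e1`, so by `e3` the difference of variances is the mean of
  -- `condMean` minus `q`, which lies between 0 and the bound `hSq`.
  rw [abs_le]
  constructor <;> nlinarith

theorem variance_sum_meanChange_le [IsProbabilityMeasure ν] (hM : HasUniformMoments P Φ) {R : ℝ}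
    (hR : HasFiniteRange P Φ R) (hΦ : Measurable Φ) (hY₁ : Measurable Y₁)
    (hY₂ : Measurable Y₂) (hY₁' : IsLocal Y₁) (hY₂' : IsLocal Y₂)
    {B : Set (Space d)} (hB : MeasurableSet B) {Z : Finset (Fin d → ℤ)} {M : ℝ≥0}
    (hMZ : ∀ z ∈ Z, ∫⁻ ω, (Φ ω).1 (cube z) ^ 2 ∂P ≤ M) :
    variance (fun ω => ∑ z ∈ Z, meanChange ν Y₁ Y₂ B z (Φ ω)) P ≤ Z.card *
      ((volume (closedBall (0 : Space d) (R + 2 * (d + 1) + d))).toReal * M) := by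
  classical
  refine variance_sum_le Z (fun z _ => memLp_meanChange hM hΦ hY₁ hY₂ hB z) (fun z hz => ?_)
    (fun z w => dist (corner z) (corner w) ≤ R + 2 * (d + 1)) (fun z _ w _ hzw =>
      covariance_meanChange_eq_zero hM hR hΦ hY₁ hY₂ hY₁' hY₂' hB (not_le.1 hzw)) fun z _ => ?_
  · exact (variance_meanChange_le hM hΦ hY₁ hY₂ hB z).trans
      (ENNReal.toReal_mono ENNReal.coe_ne_top (hMZ z hz))
  -- Cubes near `z` lie in one ball around its corner; the last summand `d` of the radius covers a
  -- cube seen from its own corner.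
  · rw [← Measure.addHaar_closedBall_center volume (corner z)]
    refine card_le_volume_toReal _ ?_ fun w hw x hx => ?_
    · exact measure_closedBall_lt_top.ne
    · have := (Finset.mem_filter.1 hw).2
      rw [mem_closedBall]
      rw [dist_comm] at this
      linarith [dist_triangle x (corner w) (corner z), dist_corner_le hx]

/-- The set of points of distance at most `a` from the sphere of radius `r`. -/
def shell (d : ℕ) (a r : ℝ) : Set (Space d) := closedBall 0 (r + a) \ closedBall 0 (r - a)

/-- It matters that `K` does not depend on `r`. The shell has half-width 2 + 2d because the cubes
meeting the shell of half-width 2 have diameter at most 2d. -/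
theorem exists_abs_variance_sub_le (hM : HasUniformMoments P Φ) {R : ℝ}
    (hR : HasFiniteRange P Φ R)
    (h : IsUpdate P Y₁ Y₂ V Φ Φ') (hY₁ : Measurable Y₁) (hY₂ : Measurable Y₂)
    (hY₁' : IsLocal Y₁) (hY₂' : IsLocal Y₂)
    (hV : ∀ i, Measurable (V i)) (hVi : iIndepFun V P)
    (hν : ∀ i, P.map (V i) = ν) (hΦ : Measurable Φ) (hΦ' : Measurable Φ') :
    ∃ K : ℝ, ∀ r,
      |variance (fun ω => ((Φ' ω).1 (closedBall 0 r)).toReal) P -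
        variance (fun ω => ((Φ ω).1 (closedBall 0 r)).toReal) P| ≤
      2 * (K * (volume (shell d (2 + 2 * d) r)).toReal) +
      2 * √(variance (fun ω => ((Φ ω).1 (closedBall 0 r)).toReal) P *
        (K * (volume (shell d (2 + 2 * d) r)).toReal)) := by
  have : IsProbabilityMeasure ν := hν 0 ▸ Measure.isProbabilityMeasure_map (hV 0).aemeasurable
  obtain ⟨M, hM'⟩ := hM d
  have hMZ : ∀ z, ∫⁻ ω, (Φ ω).1 (cube z) ^ 2 ∂P ≤ M := fun z => by
    refine le_trans (lintegral_mono fun ω => ?_) (hM' (corner z))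
    gcongr
    exact fun x hx => mem_closedBall.2 (dist_corner_le hx)
  set L := (volume (closedBall (0 : Space d) (R + 2 * (d + 1) + d))).toReal * M with hL
  have hL0 : 0 ≤ L := by positivity
  -- Per boundary cube, `L` pays for the variance of the sum of mean changes and `1 + M` for the
  -- conditional variance.
  refine ⟨L + (1 + M), fun r => ?_⟩
  set s := (volume (shell d (2 + 2 * d) r)).toReal
  have hB : MeasurableSet (closedBall (0 : Space d) r) := measurableSet_closedBall
  have hB' : Bornology.IsBounded (closedBall (0 : Space d) r) := isBounded_closedBall
  have hbdd : Bornology.IsBounded (shell d 2 r) := isBounded_closedBall.subset Set.sdiff_subset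
  let Z := (finite_cells hbdd).toFinset
  have hZ : ∀ φ x, cell x ∉ Z → hitProb ν Y₁ Y₂ (closedBall 0 r) φ x =
      (closedBall 0 r).indicator 1 x := fun φ x hx =>
    hitProb_eq_indicator (fun hx' => hx ((Set.Finite.mem_toFinset _).2 ⟨x, rfl, hx'⟩)) φ
  have hcard : (Z.card : ℝ) ≤ s := by
    refine card_le_volume_toReal _ ?_ fun z hz x hx => ?_
    · exact ((measure_mono Set.sdiff_subset).trans_lt measure_closedBall_lt_top).ne
    · obtain ⟨y, hy, hy1, hy2⟩ := (Set.Finite.mem_toFinset _).1 hz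
      have hxy := dist_le_of_mem_cube hx hy
      refine ⟨?_, fun hx' => hy2 ?_⟩
      · rw [mem_closedBall] at hy1 ⊢
        linarith [dist_triangle x y 0]
      · rw [mem_closedBall] at hx' ⊢
        linarith [dist_triangle_left y 0 x]
  have v1 := abs_variance_sub_variance_condMean_le hM h hY₁ hY₂ hV hVi hν hΦ hΦ' hB hB' hZ
    fun z _ => hMZ z
  have v2 := variance_sum_meanChange_le (ν := ν) (Z := Z) hM hR hΦ hY₁ hY₂ hY₁' hY₂' hB
    fun z _ => hMZ z
  have hS : (fun ω => (condMean ν Y₁ Y₂ (closedBall 0 r) (Φ ω)).toReal) = fun ω =>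
      ((Φ ω).1 (closedBall 0 r)).toReal +
        ∑ z ∈ Z, meanChange ν Y₁ Y₂ (closedBall 0 r) z (Φ ω) :=
    funext fun ω => (condMean_toReal_eq hB hB' (hZ (Φ ω))).2
  have mN := hM.locallySquareIntegrable hΦ _ hB hB'
  have mW : MemLp (fun ω => ∑ z ∈ Z, meanChange ν Y₁ Y₂ (closedBall 0 r) z (Φ ω)) 2 P :=
    memLp_finsetSum _ fun z _ => memLp_meanChange hM hΦ hY₁ hY₂ hB z
  have v3 := variance_fun_add mN mW
  have v4 := abs_covariance_le_sqrt mN mW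
  rw [hS, v3] at v1
  have hM0 : (0 : ℝ) ≤ M := M.2
  have v5 : (Z.card : ℝ) * (1 + M) ≤ (L + (1 + M)) * s := by
    rw [mul_comm]
    exact mul_le_mul (by linarith) hcard (by positivity) (by positivity)
  have v6 : variance (fun ω => ∑ z ∈ Z, meanChange ν Y₁ Y₂ (closedBall 0 r) z (Φ ω)) P ≤
      (L + (1 + M)) * s := by
    refine v2.trans ?_
    rw [mul_comm]
    exact mul_le_mul (by linarith) hcard (by positivity) (by positivity)
  have v7 := Real.sqrt_le_sqrt (mul_le_mul_of_nonneg_left v6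
    (variance_nonneg (fun ω => ((Φ ω).1 (closedBall 0 r)).toReal) P))
  have v8 := variance_nonneg (fun ω => ∑ z ∈ Z, meanChange ν Y₁ Y₂ (closedBall 0 r) z (Φ ω)) P
  rw [abs_le] at v1 v4 ⊢
  constructor <;> linarith [v1.1, v1.2, v4.1, v4.2]

theorem tendsto_volume_shell (d : ℕ) {a : ℝ} (ha : 0 ≤ a) :
    Tendsto (fun r : ℝ => (volume (closedBall (0 : Space d) r)).toReal⁻¹ *
      (volume (shell d a r)).toReal) atTop (𝓝 0) := by
  have h1 : Tendsto (fun r : ℝ => (1 + a / r) ^ d - (1 - a / r) ^ d) atTop (𝓝 0) := by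
    have h := (tendsto_const_nhds (x := a)).div_atTop tendsto_id
    simpa using ((h.const_add 1).pow d).sub ((h.const_sub 1).pow d)
  refine h1.congr' ?_
  filter_upwards [eventually_ge_atTop a, eventually_gt_atTop 0] with r hr hr0
  have hc : 0 < (volume (ball (0 : Space d) 1)).toReal :=
    ENNReal.toReal_pos (measure_ball_pos volume _ one_pos).ne' measure_ball_lt_top.ne
  have hv : ∀ ρ : ℝ, 0 ≤ ρ → (volume (closedBall (0 : Space d) ρ)).toReal =
      ρ ^ d * (volume (ball (0 : Space d) 1)).toReal := fun ρ hρ => by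
    simpa [measureReal_def] using Measure.addHaar_real_closedBall volume (0 : Space d) hρ
  have hs : (volume (shell d a r)).toReal =
      (volume (closedBall (0 : Space d) (r + a))).toReal -
      (volume (closedBall (0 : Space d) (r - a))).toReal := by
    rw [shell, measure_sdiff (closedBall_subset_closedBall (by linarith))
      measurableSet_closedBall.nullMeasurableSet measure_closedBall_lt_top.ne,
      ENNReal.toReal_sub_of_le (measure_mono (closedBall_subset_closedBall (by linarith)))
      measure_closedBall_lt_top.ne]
  rw [hs, hv _ hr0.le, hv _ (by linarith), hv _ (by linarith),
    show 1 + a / r = (r + a) / r by field_simp, show 1 - a / r = (r - a) / r by field_simp,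
    div_pow, div_pow]
  field_simp

-- Normalisation by the volume enters the square root once per factor: Var N divided by the volume
-- converges, and the shell divided by the volume tends to 0, so their product tends to 0.
omit [IsProbabilityMeasure P] in
theorem HasAsymptoticVariance.of_abs_sub_le {σ K a : ℝ} (ha : 0 ≤ a)
    (h : HasAsymptoticVariance P Φ σ)
    (hK : ∀ r, |variance (fun ω => ((Φ' ω).1 (closedBall 0 r)).toReal) P -
        variance (fun ω => ((Φ ω).1 (closedBall 0 r)).toReal) P| ≤
      2 * (K * (volume (shell d a r)).toReal) +
      2 * √(variance (fun ω => ((Φ ω).1 (closedBall 0 r)).toReal) P *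
        (K * (volume (shell d a r)).toReal))) :
    HasAsymptoticVariance P Φ' σ := by
  have hs := (tendsto_volume_shell d ha).const_mul K
  rw [mul_zero] at hs
  have hlim := (hs.const_mul 2).add ((h.mul hs).sqrt.const_mul 2)
  simp only [mul_zero, Real.sqrt_zero, add_zero] at hlim
  have hdiff : Tendsto (fun r : ℝ => (volume (closedBall (0 : Space d) r)).toReal⁻¹ *
      (variance (fun ω => ((Φ' ω).1 (closedBall 0 r)).toReal) P -
        variance (fun ω => ((Φ ω).1 (closedBall 0 r)).toReal) P)) atTop (𝓝 0) := by
    refine squeeze_zero_norm (fun r => ?_) hlim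
    set w := (volume (closedBall (0 : Space d) r)).toReal⁻¹
    have hw : 0 ≤ w := by positivity
    rw [norm_mul, Real.norm_of_nonneg hw, Real.norm_eq_abs]
    refine (mul_le_mul_of_nonneg_left (hK r) hw).trans_eq ?_
    generalize (volume (shell d a r)).toReal = s
    generalize variance (fun ω => ((Φ ω).1 (closedBall 0 r)).toReal) P = v
    rw [show w * v * (K * (w * s)) = (w * w) * (v * (K * s)) by ring,
      Real.sqrt_mul (mul_nonneg hw hw), Real.sqrt_mul_self hw]
    ring
  have := h.add hdiff
  rw [add_zero] at this
  refine this.congr fun r => ?_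
  ring

end

/-! ### The Poisson process: moments, variance, and range 0. -/

section

variable {d : ℕ}

theorem lintegral_poissonMeasure {s : ℝ≥0} {g : ℕ → ℝ} (hg : ∀ n, 0 ≤ g n) {a : ℝ}
    (h : HasSum (fun n : ℕ => Real.exp (-s) * s ^ n / n.factorial * g n) a) :
    ∫⁻ n, ENNReal.ofReal (g n) ∂(poissonMeasure s) = ENNReal.ofReal a := by
  rw [poissonMeasure, lintegral_sum_measure, ← h.tsum_eq, ENNReal.ofReal_tsum_of_nonneg
    (fun n => mul_nonneg (by positivity) (hg n)) h.summable]
  refine tsum_congr fun n => ?_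
  rw [lintegral_smul_measure, lintegral_dirac, smul_eq_mul, ENNReal.ofReal_mul (by positivity)]

theorem lintegral_id_poissonMeasure (s : ℝ≥0) : ∫⁻ n, (n : ℝ≥0∞) ∂(poissonMeasure s) = s := by
  have h : HasSum (fun n : ℕ => Real.exp (-s) * s ^ n / n.factorial * n) s := by
    rw [← hasSum_nat_add_iff' 1]
    have := (hasSum_one_poissonMeasure s).mul_left (s : ℝ)
    simp only [Finset.range_one, Finset.sum_singleton, Nat.cast_zero, mul_zero, sub_zero]
    convert! this using 1
    · funext n
      rw [Nat.factorial_succ]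
      push_cast
      field_simp
      ring
    · simp
  simpa using lintegral_poissonMeasure (fun n => Nat.cast_nonneg n) h

/-- The second factorial moment is s²: the weight n(n - 1) kills the first two terms and cancels
against n!, leaving an index shift by 2. -/
theorem lintegral_sq_poissonMeasure (s : ℝ≥0) :
    ∫⁻ n, (n : ℝ≥0∞) ^ 2 ∂(poissonMeasure s) = s ^ 2 + s := by
  have h : HasSum (fun n : ℕ => Real.exp (-s) * s ^ n / n.factorial * (n * (n - 1)))
      ((s : ℝ) ^ 2) := by
    rw [← hasSum_nat_add_iff' 2]
    have := (hasSum_one_poissonMeasure s).mul_left ((s : ℝ) ^ 2)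
    convert! this using 1
    · funext n
      rw [Nat.factorial_succ, Nat.factorial_succ]
      push_cast
      have h1 : (n : ℝ) + 1 ≠ 0 := by positivity
      have h2 : (n : ℝ) + 1 + 1 ≠ 0 := by positivity
      field_simp
      ring
    · simp [Finset.sum_range_succ]
  have hg : ∀ n : ℕ, 0 ≤ (n : ℝ) * (n - 1) := fun n => by
    rcases n with _ | n
    · simp
    · push_cast
      rw [add_sub_cancel_right]
      positivity
  have h1 := lintegral_poissonMeasure hg h
  have h2 : ∀ n : ℕ, (n : ℝ≥0∞) ^ 2 = ENNReal.ofReal ((n : ℝ) * (n - 1)) + n := fun n => by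
    rw [← ENNReal.ofReal_natCast, ← ENNReal.ofReal_pow (Nat.cast_nonneg n),
      ← ENNReal.ofReal_add (hg n) (Nat.cast_nonneg n)]
    congr 1
    ring
  simp_rw [h2]
  rw [lintegral_add_left .of_discrete, h1, lintegral_id_poissonMeasure,
    ENNReal.ofReal_pow (p := (s : ℝ)) s.2, ENNReal.ofReal_coe_nnreal]

variable {Ω : Type*} [MeasurableSpace Ω] {P : Measure Ω}
  {Φ : Ω → PointMeasure d} {γ : ℝ≥0}

theorem IsStationaryPoisson.lintegral_comp (h : IsStationaryPoisson P γ Φ) {B : Set (Space d)}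
    (hB : MeasurableSet B) (hB' : volume B < ∞) {g : ℝ≥0∞ → ℝ≥0∞} (hg : Measurable g) :
    ∫⁻ ω, g ((Φ ω).1 B) ∂P = ∫⁻ n, g (n : ℝ≥0∞) ∂(poissonMeasure (γ * (volume B).toNNReal)) := by
  rw [← lintegral_map (f := g) (g := fun ω => (Φ ω).1 B) hg
    ((measurable_eval hB).comp h.measurable), h.counts B hB hB',
    lintegral_map hg .of_discrete]

theorem IsStationaryPoisson.hasUniformMoments (h : IsStationaryPoisson P γ Φ) :
    HasUniformMoments P Φ := by
  intro ρ
  set s := γ * (volume (closedBall (0 : Space d) ρ)).toNNReal with hs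
  refine ⟨s ^ 2 + s, fun x => ?_⟩
  have := h.lintegral_comp (B := closedBall x ρ) measurableSet_closedBall
    measure_closedBall_lt_top (measurable_id.pow_const 2)
  simp only [id] at this
  rw [this, Measure.addHaar_closedBall_center volume x ρ, lintegral_sq_poissonMeasure]
  push_cast
  rfl

theorem IsStationaryPoisson.variance_eq [IsProbabilityMeasure P] (h : IsStationaryPoisson P γ Φ)
    {B : Set (Space d)} (hB : MeasurableSet B) (hB' : Bornology.IsBounded B) :
    variance (fun ω => ((Φ ω).1 B).toReal) P = γ * (volume B).toReal := by
  have hm : Measurable fun ω => (Φ ω).1 B := (measurable_eval hB).comp h.measurable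
  have e1 := h.lintegral_comp hB hB'.measure_lt_top (measurable_id.pow_const 2)
  have e2 := h.lintegral_comp hB hB'.measure_lt_top measurable_id
  simp only [id] at e1 e2
  rw [variance_toReal hm (h.hasUniformMoments.ne_top hB'), e1, e2, lintegral_sq_poissonMeasure,
    lintegral_id_poissonMeasure, ENNReal.toReal_add (by finiteness) (by finiteness),
    ENNReal.toReal_pow]
  simp only [ENNReal.coe_toReal, add_sub_cancel_left]
  rw [NNReal.coe_mul]
  rfl

theorem IsStationaryPoisson.hasAsymptoticVariance [IsProbabilityMeasure P]
    (h : IsStationaryPoisson P γ Φ) : HasAsymptoticVariance P Φ γ := by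
  refine (tendsto_const_nhds (x := (γ : ℝ))).congr' ?_
  filter_upwards [eventually_gt_atTop 0] with r hr
  rw [h.variance_eq measurableSet_closedBall isBounded_closedBall]
  have hv : (volume (closedBall (0 : Space d) r)).toReal ≠ 0 :=
    (ENNReal.toReal_pos (measure_closedBall_pos volume _ hr).ne' measure_closedBall_lt_top.ne).ne'
  field_simp

theorem IsStationaryPoisson.lintegral_expNeg_sum (h : IsStationaryPoisson P γ Φ) {m : ℕ}
    {ι : Type*} [Fintype ι] (e : Fin m ≃ ι) {D : ι → Set (Space d)} (hD : ∀ i, MeasurableSet (D i))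
    (hD' : ∀ i, Bornology.IsBounded (D i)) (hdisj : Pairwise (Function.onFun Disjoint D))
    (w : ι → ℕ) :
    ∫⁻ ω, expNeg (∑ i, w i * (Φ ω).1 (D i)) ∂P = ∏ i, ∫⁻ ω, expNeg (w i * (Φ ω).1 (D i)) ∂P := by
  have hind := (h.indep m (fun j => D (e j)) (fun j => hD _)
    fun i j hij => hdisj (e.injective.ne hij)).precomp (g := e.symm) e.symm.injective
  simp only [Equiv.apply_symm_apply] at hind
  have hm : ∀ i, Measurable fun t : ℝ≥0∞ => expNeg (w i * t) := fun i =>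
    measurable_expNeg.comp (measurable_const_mul _)
  refine (lintegral_congr fun ω => ?_).trans
    (lintegral_prod_eq_prod_lintegral_of_indepFun Finset.univ _ (hind.comp _ hm)
      fun i => (hm i).comp ((measurable_eval (hD i)).comp h.measurable))
  rw [expNeg_sum _ fun i _ => ENNReal.mul_ne_top (by simp)
    (measure_lt_top_of_isBounded _ (hD' i)).ne]

/-- The levels start at 1: level 0 adds nothing to the integral and need not be contained in `A`. -/
theorem IsTest.exists_levelSets {A : Set (Space d)} {f : Space d → ℕ} (hf : IsTest A f) :
    ∃ (N : ℕ) (D : Fin N → Set (Space d)) (w : Fin N → ℕ), (∀ i, MeasurableSet (D i)) ∧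
      (∀ i, D i ⊆ A) ∧ Pairwise (Function.onFun Disjoint D) ∧
      ∀ φ : PointMeasure d, ∫⁻ x, f x ∂φ.1 = ∑ i, w i * φ.1 (D i) := by
  obtain ⟨N, hN⟩ := hf.bounded
  have hD : ∀ i : Fin N, MeasurableSet (f ⁻¹' {(i : ℕ) + 1}) := fun i =>
    hf.measurable (measurableSet_singleton _)
  refine ⟨N, fun i => f ⁻¹' {(i : ℕ) + 1}, fun i => i + 1, hD,
    fun i x hx => ?_, fun i j hij => ?_, fun φ => ?_⟩
  · by_contra hA
    have h1 : f x = i + 1 := hx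
    have h2 := hf.support x hA
    omega
  · exact Disjoint.preimage _ (Set.disjoint_singleton.2 fun h => hij (Fin.ext (by omega)))
  · have h : ∀ x, (f x : ℝ≥0∞) =
        ∑ i : Fin N, ((i + 1 : ℕ) : ℝ≥0∞) * (f ⁻¹' {(i : ℕ) + 1}).indicator 1 x := by
      intro x
      by_cases hx : f x = 0
      · rw [Finset.sum_eq_zero fun i _ => ?_, hx, Nat.cast_zero]
        rw [Set.indicator_of_notMem, mul_zero]
        intro hi
        have hi' : f x = i + 1 := hi
        omega
      · have hlt : f x - 1 < N := by have := hN x; omega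
        rw [Finset.sum_eq_single (⟨f x - 1, hlt⟩ : Fin N)]
        · rw [Set.indicator_of_mem, Pi.one_apply, mul_one]
          · congr 1
            show f x = f x - 1 + 1
            omega
          · show f x = f x - 1 + 1
            omega
        · intro i _ hi
          rw [Set.indicator_of_notMem, mul_zero]
          intro hi'
          have hi'' : f x = i + 1 := hi'
          exact hi (Fin.ext (by simp [hi'']))
        · simp
    simp_rw [h]
    rw [lintegral_finsetSum _ fun i _ => (measurable_one.indicator (hD i)).const_mul _]
    refine Finset.sum_congr rfl fun i _ => ?_
    rw [lintegral_const_mul _ (measurable_one.indicator (hD i)), lintegral_indicator_one (hD i)]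

/-- The level sets of both test functions form one finite disjoint family, over which the Poisson
counts are independent, so the Laplace functional factorises. -/
theorem IsStationaryPoisson.hasFiniteRange [IsProbabilityMeasure P]
    (h : IsStationaryPoisson P γ Φ) : HasFiniteRange P Φ 0 := by
  intro A B hA hB hA' hB' hAB
  refine indepFun_restrictTo_of_laplace h.measurable hA hB hA' hB' fun f g hf hg => ?_
  have hdisj : Disjoint A B := Set.disjoint_left.2 fun x hxA hxB => by
    simpa using hAB x hxA x hxB
  obtain ⟨M, C, v, hC, hCA, hCd, hfC⟩ := hf.exists_levelSets
  obtain ⟨N, D, w, hD, hDB, hDd, hgD⟩ := hg.exists_levelSets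
  have hC' : ∀ i, Bornology.IsBounded (C i) := fun i => hA'.subset (hCA i)
  have hD' : ∀ i, Bornology.IsBounded (D i) := fun i => hB'.subset (hDB i)
  have hsum := h.lintegral_expNeg_sum finSumFinEquiv.symm (D := Sum.elim C D)
    (by rintro (i | i); exacts [hC i, hD i]) (by rintro (i | i); exacts [hC' i, hD' i])
    (by
      rintro (i | i) (j | j) hij
      · exact hCd fun h => hij (congrArg _ h)
      · exact hdisj.mono (hCA i) (hDB j)
      · exact (hdisj.mono (hCA j) (hDB i)).symm
      · exact hDd fun h => hij (congrArg _ h)) (Sum.elim v w)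
  have hf1 := h.lintegral_expNeg_sum (Equiv.refl _) hC hC' hCd v
  have hg1 := h.lintegral_expNeg_sum (Equiv.refl _) hD hD' hDd w
  simp only [Fintype.sum_sum_type, Fintype.prod_sum_type, Sum.elim_inl, Sum.elim_inr] at hsum
  simp only [laplace, lintegral_add_left hf.measurable_coe, hfC, hgD]
  rw [hsum, hf1, hg1]

end

end RandomOrganization

end

/-! ### Induction over the updates. -/

theorem proposition7p2
    {d : ℕ} (hd : 1 ≤ d) {γ : ℝ≥0} (hγ : γ ≠ 0)
    {Ω : Type*} [MeasurableSpace Ω] (P : Measure Ω) [IsProbabilityMeasure P]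
    (Y₁ : RandomOrganization.PointMeasure d → ({0, 1} : Set ℝ))
    (Y₂ : RandomOrganization.PointMeasure d → RandomOrganization.UnitBall d)
    (hY₁ : Measurable Y₁) (hY₂ : Measurable Y₂)
    (hY₁_local : RandomOrganization.IsLocal Y₁) (hY₂_local : RandomOrganization.IsLocal Y₂)
    (U : ℕ → ℕ → Ω → RandomOrganization.UnitBall d)
    (hU : ∀ k i, Measurable (U k i))
    (hU_indep : iIndepFun (fun p : ℕ × ℕ => U p.1 p.2) P)
    (hU_ident : ∀ k i, IdentDistrib (U k i) (U 0 0) P P)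
    (Φ : ℕ → Ω → RandomOrganization.PointMeasure d)
    (hΦ_meas : ∀ k, Measurable (Φ k))
    (hΦ_poisson : RandomOrganization.IsStationaryPoisson P γ (Φ 0))
    (hΦU : IndepFun (fun ω (p : ℕ × ℕ) => U p.1 p.2 ω) (Φ 0) P)
    (hΦ_step : ∀ k, RandomOrganization.IsUpdate P Y₁ Y₂ (U k) (Φ k) (Φ (k + 1))) :
    (RandomOrganization.LocallySquareIntegrable P (Φ 0) ∧
      RandomOrganization.HasAsymptoticVariance P (Φ 0) γ) ∧
    ∀ k : ℕ, 1 ≤ k →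
      RandomOrganization.LocallySquareIntegrable P (Φ k) ∧
      RandomOrganization.HasAsymptoticVariance P (Φ k) γ ∧
      ¬ RandomOrganization.IsHyperuniform P (Φ k) := by
  have hind : ∀ k, iIndepFun (U k) P := fun k =>
    hU_indep.precomp (g := fun i => (k, i)) (Prod.mk_right_injective k)
  have hlaw : ∀ k i, P.map (U k i) = P.map (U 0 0) := fun k i => (hU_ident k i).map_eq
  -- Moments and finite range are carried along because the comparison of variances at the next step
  -- needs both.
  have key : ∀ k, RandomOrganization.HasUniformMoments P (Φ k) ∧
      (∃ R, 0 ≤ R ∧ RandomOrganization.HasFiniteRange P (Φ k) R) ∧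
      RandomOrganization.HasAsymptoticVariance P (Φ k) γ := by
    intro k
    induction k with
    | zero =>
      exact ⟨hΦ_poisson.hasUniformMoments, ⟨0, le_rfl, hΦ_poisson.hasFiniteRange⟩,
        hΦ_poisson.hasAsymptoticVariance⟩
    | succ k ih =>
      obtain ⟨hM, ⟨R, hR0, hR⟩, hV⟩ := ih
      have hstep := hΦ_step k
      obtain ⟨K, hK⟩ := RandomOrganization.exists_abs_variance_sub_le hM hR hstep hY₁ hY₂
        hY₁_local hY₂_local (hU k) (hind k) (hlaw k) (hΦ_meas k) (hΦ_meas (k + 1))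
      exact ⟨hM.update hstep, ⟨R + 8, by linarith, hR.update hR0 hstep hY₁ hY₂ hY₁_local
        hY₂_local (hU k) (hind k) (hlaw k) (hΦ_meas k) (hΦ_meas (k + 1))⟩,
        hV.of_abs_sub_le (by positivity) hK⟩
  refine ⟨⟨(key 0).1.locallySquareIntegrable (hΦ_meas 0), (key 0).2.2⟩, fun k _ =>
    ⟨(key k).1.locallySquareIntegrable (hΦ_meas k), (key k).2.2, fun h => hγ ?_⟩⟩
  -- Hyperuniformity would make 0 a second limit besides `γ`.
  exact_mod_cast tendsto_nhds_unique (key k).2.2 h
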